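/- **Setting.** Let $N\ge 1$, let $e_1,\dots,e_m\in\mathbb Z^N$ span $\mathbb R^N$ and be pairwise distinct up to sign, and let $\beta:\mathbb Z^N\to[0,\infty)$ satisfy $\beta(-i)=\beta(i)$ and $\beta(i)>0$ if and only if $i\in\{\pm e_1,\dots,\pm e_m\}$. Put $$\phi(v)=\sum_{k=1}^m 2\beta(e_k)|v\cdot e_k|,\qquad \phi^\circ(x)=\sup\{x\cdot v:\phi(v)\le 1\},\qquad \mathcal W_R=\{y\in\mathbb R^N:\phi^\circ(y)<R\}.$$ Let $\varepsilon,h>0$. A function $u:\varepsilon\mathbb Z^N\to\mathbb R$ is $(1,\phi^\circ)$-Lipschitz if $|u_i-u_j|\le\phi^\circ(i-j)$ for all $i,j\in\varepsilon\mathbb Z^N$. For such a $u$ with $\{u\le 0\}$ and $\{u\ge 0\}$ nonempty, set $$d_-(u)_i=\sup_{u_j\ge 0}\{u_j-\phi^\circ(i-j)\},\quad \mathrm{sd}_-(u)_i=\inf_{u_j\le 0}\{d_-(u)_j+\phi^\circ(i-j)\},$$ $$d_+(u)_i=\inf_{u_j\le 0}\{u_j+\phi^\circ(i-j)\},\quad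 \mathrm{sd}_+(u)_i=\sup_{u_j\ge 0}\{d_+(u)_j-\phi^\circ(i-j)\},$$ and $\mathrm{sd}(u)=\tfrac12\mathrm{sd}_+(u)+\tfrac12\mathrm{sd}_-(u)$. A *discrete evolution* of a set $E_0\subseteq\mathbb R^N$ consists of sets $E^k\subseteq\varepsilon\mathbb Z^N$ and functions $u^k:\varepsilon\mathbb Z^N\to\mathbb R$, $k\ge 0$, such that: * $E^0=\{i\in\varepsilon\mathbb Z^N:(i+[0,\varepsilon)^N)\cap E_0\ne\emptyset\}$, and $u^0$ is any $(1,\phi^\circ)$-Lipschitz function that is negative on $E^0$ and positive on $\varepsilon\mathbb Z^N\setminus E^0$; * if $E^k\notin\{\emptyset,\varepsilon\mathbb Z^N\}$, then $E^{k+1}=\{u^{k+1}\le 0\}$, where for some $z:\varepsilon\mathbb Z^N\times\varepsilon\mathbb Z^N\to\mathbb R$ and all $i,j\in\varepsilon\mathbb Z^N$ $$\frac h\varepsilon\sum_{l\in\varepsilon\mathbb Z^N}(z_{il}-z_{li})+u^{k+1}_i=\mathrm{sd}(u^k)_i,\qquad z_{ij}(u^{k+1}_i-u^{k+1}_j)=\beta\big(\tfrac{i-j}\varepsilon\big)|u^{k+1}_i-u^{k+1}_j|,\qquad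 |z_{ij}|\le\beta\big(\tfrac{i-j}\varepsilon\big);$$ * if $E^k\in\{\emptyset,\varepsilon\mathbb Z^N\}$, then $E^{k+1}=E^k$. For $t\ge 0$ its set at time $t$ is $E^{\lfloor t/h\rfloor}$. Consider the condition (RZ) there is $L>0$ such that for every $s\in\{0,1,-1\}^m$ there is $\ell\in(0,L]$ with $\ell\sum_{k=1}^m 2\beta(e_k)s_k e_k\in\mathbb Z^N$ (it holds, for instance, if all the weights $\beta(e_k)$ are rational). **Proposition.** Let $K\in\mathbb R$. For every $\delta>0$ there exist constants $\varepsilon_0,h_0,c_0>0$, depending only on $\delta$, $K$ and the data $(e_k)_k,\beta$, such that the following holds whenever $0<\varepsilon\le\varepsilon_0$, $0<h\le h_0$, $R\ge\delta$, and either $\varepsilon\le Kh$ or (RZ) holds. Let $\mathcal W^h(t)$ be the set at time $t$ of any discrete evolution of $\mathcal W_R$, or of its closure $\overline{\mathcal W_R}$. Then $$\mathcal W^h(t)\supseteq \mathcal W_{R-c_0(t+\varepsilon)}\cap\varepsilon\mathbb Z^N$$ for every $t\ge 0$ such that $R-c_0(t+\varepsilon)\ge\delta/2$. -/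

import Mathlib

namespace CrystalScheme

/-- The data of the scheme: finitely many integer vectors `e 0, …, e (m-1)` which span `ℝ^N` and are
pairwise distinct up to sign, and an even nonnegative interaction function `β` on `ℤ^N` which is
positive exactly on `{± e k}`. -/
structure Interaction (N m : ℕ) where
  e : Fin m → (Fin N → ℤ)
  β : (Fin N → ℤ) → ℝ
  span_e : Submodule.span ℝ (Set.range fun k : Fin m => fun a : Fin N => (e k a : ℝ)) = ⊤
  distinct : ∀ k l, k ≠ l → e k ≠ e l ∧ e k ≠ -e l
  nonneg : ∀ i, 0 ≤ β i
  even : ∀ i, β (-i) = β i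
  pos_iff : ∀ i, 0 < β i ↔ ∃ k, i = e k ∨ i = -e k

/-- The polar of `φ`: `φ°(x) = sup {x · v : φ(v) ≤ 1}`. The supremum is finite when `φ` is a norm. -/
noncomputable def polar {N : ℕ} (φ : (Fin N → ℝ) → ℝ) (x : Fin N → ℝ) : ℝ :=
  sSup {s : ℝ | ∃ v : Fin N → ℝ, φ v ≤ 1 ∧ s = ∑ a, x a * v a}

/-- The point `ε n` of the lattice `ε ℤ^N`. For `ε > 0` the lattice is parametrized by
`n ∈ ℤ^N`, and functions on `ε ℤ^N` are written as functions of `n`. -/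
def point {N : ℕ} (ε : ℝ) (n : Fin N → ℤ) : Fin N → ℝ := fun a => ε * (n a : ℝ)

/-- The lattice `ε ℤ^N` as a subset of `ℝ^N`. -/
def lattice (N : ℕ) (ε : ℝ) : Set (Fin N → ℝ) := Set.range (point ε)

/-- The adjoint of the discrete gradient, `(D*_ε z)_i = ∑_j (z_ij - z_ji) / ε`.
(It is only used for `z` with finitely many nonzero terms in each such sum.) -/
noncomputable def adjGrad {N : ℕ} (ε : ℝ) (z : (Fin N → ℤ) → (Fin N → ℤ) → ℝ)
    (i : Fin N → ℤ) : ℝ :=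
  ∑' j, (z i j - z j i) / ε

/-- The discretization of an initial set: those `i` whose cell `ε i + [0, ε)^N` meets `E₀`. -/
def initialSet {N : ℕ} (ε : ℝ) (E₀ : Set (Fin N → ℝ)) :
    Set (Fin N → ℤ) :=
  {i | ∃ x ∈ E₀, ∀ a, point ε i a ≤ x a ∧ x a < point ε i a + ε}

namespace Interaction

variable {N m : ℕ} (I : Interaction N m)

/-- The anisotropy `φ(v) = ∑_k 2 β(e_k) |v · e_k|`. -/
noncomputable def phi (v : Fin N → ℝ) : ℝ :=
  ∑ k, 2 * I.β (I.e k) * |∑ a, v a * (I.e k a : ℝ)|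

/-- The polar norm `φ°`. -/
noncomputable def phiPolar (x : Fin N → ℝ) : ℝ := polar I.phi x

/-- The (open) Wulff shape of radius `R` centred at the origin. -/
def wulff (R : ℝ) : Set (Fin N → ℝ) := {y | I.phiPolar y < R}

/-- There is `L > 0` such that for all signs `s_k ∈ {0, 1, -1}` some multiple
`ℓ ∑_k 2 β(e_k) s_k e_k` with `0 < ℓ ≤ L` is an integer vector. -/
def RationalZonotope : Prop :=
  ∃ L : ℝ, 0 < L ∧ ∀ s : Fin m → ℤ, (∀ k, s k = 0 ∨ s k = 1 ∨ s k = -1) →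
    ∃ ℓ : ℝ, 0 < ℓ ∧ ℓ ≤ L ∧ ∃ p : Fin N → ℤ, ∀ a,
      ℓ * ∑ k, 2 * I.β (I.e k) * (s k : ℝ) * (I.e k a : ℝ) = (p a : ℝ)

/-- The distance `φ°(i - j)` between the lattice points `ε i` and `ε j`. -/
noncomputable def latDist (ε : ℝ) (i j : Fin N → ℤ) : ℝ := I.phiPolar (point ε i - point ε j)

/-- `u` is `(1, φ°)`-Lipschitz on `ε ℤ^N`. -/
def IsLip (ε : ℝ) (u : (Fin N → ℤ) → ℝ) : Prop := ∀ i j, |u i - u j| ≤ I.latDist ε i j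

/- The redistancing operators. The suprema and infima are over nonempty bounded sets of reals as
soon as `u` is `(1, φ°)`-Lipschitz and both `{u ≤ 0}` and `{u ≥ 0}` are nonempty. -/

noncomputable def dMinus (ε : ℝ) (u : (Fin N → ℤ) → ℝ) (i : Fin N → ℤ) : ℝ :=
  ⨆ j : {j // 0 ≤ u j}, (u j - I.latDist ε i j)

noncomputable def sdMinus (ε : ℝ) (u : (Fin N → ℤ) → ℝ) (i : Fin N → ℤ) : ℝ :=
  ⨅ j : {j // u j ≤ 0}, (I.dMinus ε u j + I.latDist ε i j)

noncomputable def dPlus (ε : ℝ) (u : (Fin N → ℤ) → ℝ) (i : Fin N → ℤ) : ℝ :=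
  ⨅ j : {j // u j ≤ 0}, (u j + I.latDist ε i j)

noncomputable def sdPlus (ε : ℝ) (u : (Fin N → ℤ) → ℝ) (i : Fin N → ℤ) : ℝ :=
  ⨆ j : {j // 0 ≤ u j}, (I.dPlus ε u j - I.latDist ε i j)

/-- The discrete signed distance function. -/
noncomputable def sd (ε : ℝ) (u : (Fin N → ℤ) → ℝ) (i : Fin N → ℤ) : ℝ :=
  1 / 2 * I.sdPlus ε u i + 1 / 2 * I.sdMinus ε u i

/-- `(u, z)` solves the Euler-Lagrange system of the discrete Rudin-Osher-Fatemi problem on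
`ε ℤ^N` with datum `g` and time step `h`; here `α_ij = β(i - j)` in the parametrization by
`ℤ^N`. -/
structure SolvesROF (ε h : ℝ) (g u : (Fin N → ℤ) → ℝ)
    (z : (Fin N → ℤ) → (Fin N → ℤ) → ℝ) : Prop where
  eq : ∀ i, h * adjGrad ε z i + u i = g i
  calibrates : ∀ i j, z i j * (u i - u j) = I.β (i - j) * |u i - u j|
  bound : ∀ i j, |z i j| ≤ I.β (i - j)

/-- `(E k)`, with level set functions `(u k)`, is a discrete evolution with initial set `E₀`. The
initial function is any `(1, φ°)`-Lipschitz function, negative on the discretization of `E₀` and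
positive outside. As long as `E k` is neither empty nor the whole lattice, `u (k + 1)` solves the
discrete system with datum `sd (u k)` and `E (k + 1) = {u (k + 1) ≤ 0}`; otherwise the set stays
constant. -/
structure IsEvolution (ε h : ℝ) (E₀ : Set (Fin N → ℝ)) (u : ℕ → (Fin N → ℤ) → ℝ)
    (E : ℕ → Set (Fin N → ℤ)) : Prop where
  init : E 0 = initialSet ε E₀
  init_lip : I.IsLip ε (u 0)
  init_neg : ∀ i ∈ E 0, u 0 i < 0
  init_pos : ∀ i ∉ E 0, 0 < u 0 i
  step : ∀ k, E k ≠ ∅ → E k ≠ Set.univ →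
    (∃ z, I.SolvesROF ε h (I.sd ε (u k)) (u (k + 1)) z) ∧ E (k + 1) = {i | u (k + 1) i ≤ 0}
  frozen : ∀ k, (E k = ∅ ∨ E k = Set.univ) → E (k + 1) = E k

end Interaction

/-- The set at time `t`, `E^{[t/h]}`, as a subset of `ε ℤ^N ⊆ ℝ^N`. -/
noncomputable def evolvedSet {N : ℕ} (ε h : ℝ) (E : ℕ → Set (Fin N → ℤ)) (t : ℝ) :
    Set (Fin N → ℝ) :=
  point ε '' E ⌊t / h⌋₊

end CrystalScheme

/-! The evolution is kept below a shrinking barrier: the truncated cone max(φ°, r) − R, with r a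
fixed fraction of δ. `Barrier` says that the signed distance lies below such a cone, and each time
step lowers R by at most a constant times h.

The unit ball of φ° is the zonotope of all ∑ 2β(e_k) y_k e_k with |y_k| ≤ 1 (`exists_zono_eq`).
Optimal coefficients y_k of a lattice point can be chosen Lipschitz in that point
(`exists_lipschitz_zono`); divided by max(φ°, r), they define a field on the edges of the lattice
whose divergence is at most C/r, uniformly in ε (`exists_calibration`). The field calibrates the
cone because a step −e_k can decrease φ° only if y_k is saturated, y_k = φ°
(`coeff_eq_of_phiPolar_lt`). By comparison, the variational step raises the cone by at most C h/r
(`exists_step_bound`).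

Redistancing preserves the cone bound up to an error η in realizing φ° by lattice points
(`sd_bounds`). Rounding a segment gives η = O(ε), which is O(h) if ε ≤ K h; under the rationality
condition exact lattice geodesics give η = 0 (`exists_path_error`). The initial redistancing costs
O(ε) once (`exists_initial_error`). Induction over the steps (`Barrier.succ`) adds up these losses.
-/

namespace CrystalScheme

/-! ### Lipschitz selection for linear inequalities -/

/-- Fourier–Motzkin elimination: the solutions of a finite system of linear inequalities can be
selected in a Lipschitz way in terms of the right-hand side. -/
theorem exists_lipschitz_selection (n : ℕ) :
    ∀ (ι : Type) [Finite ι] (a : ι → Fin n → ℝ),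
      ∃ (Y : (ι → ℝ) → Fin n → ℝ) (C : ℝ), 0 ≤ C ∧
        (∀ b b' M, 0 ≤ M → (∀ r, |b r - b' r| ≤ M) → ∀ k, |Y b k - Y b' k| ≤ C * M) ∧
        ∀ b, (∃ y : Fin n → ℝ, ∀ r, ∑ k, a r k * y k ≤ b r) → ∀ r, ∑ k, a r k * Y b k ≤ b r := by
  classical
  induction n with
  | zero =>
    intro ι _ a
    refine ⟨fun _ => Fin.elim0, 0, le_rfl, fun _ _ _ _ _ k => k.elim0, ?_⟩
    rintro b ⟨y, hy⟩ r
    simpa using hy r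
  | succ n ih =>
    intro ι _ a
    have := Fintype.ofFinite ι
    -- Eliminating the variable 0 leaves one inequality for each pair of an upper bound (positive
    -- coefficient) and a lower bound (negative coefficient), plus the rows that do not involve it.
    let ι' := {q : ι × ι // 0 < a q.1 0 ∧ a q.2 0 < 0} ⊕ {r : ι // a r 0 = 0}
    let comb (f : ι → ℝ) : ι' → ℝ := Sum.elim
      (fun q => -a q.1.2 0 * f q.1.1 + a q.1.1 0 * f q.1.2) (fun r => f r.1)
    obtain ⟨Y', C', hC', hLip', hY'⟩ := ih ι' fun r' k => comb (fun r => a r k.succ) r'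
    -- bounds for the eliminated variable
    let f (b : ι → ℝ) (r : ι) : ℝ := (b r - ∑ k, a r (Fin.succ k) * Y' (comb b) k) / a r 0
    let neg : Finset ι := Finset.univ.filter fun r => a r 0 < 0
    let pos : Finset ι := Finset.univ.filter fun r => 0 < a r 0
    -- The largest lower bound if there is one, otherwise the smallest upper bound, otherwise 0. A
    -- finite maximum or minimum inherits the Lipschitz bound.
    let y₀ (b : ι → ℝ) : ℝ :=
      if h : neg.Nonempty then neg.sup' h (f b) else
        if h : pos.Nonempty then pos.inf' h (f b) else 0
    obtain ⟨D, hD0, hD⟩ : ∃ D : ℝ, 0 ≤ D ∧ ∀ b b' M, 0 ≤ M → (∀ r, |b r - b' r| ≤ M) →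
        ∀ k, |Y' (comb b) k - Y' (comb b') k| ≤ D * M := by
      let A : ℝ := ∑ r, |a r 0|
      have hA : ∀ r, |a r 0| ≤ A := fun r =>
        Finset.single_le_sum (f := fun r => |a r 0|) (fun _ _ => abs_nonneg _) (Finset.mem_univ r)
      have hA0 : 0 ≤ A := Finset.sum_nonneg fun _ _ => abs_nonneg _
      refine ⟨C' * (2 * A + 1), by positivity, fun b b' M hM hb k => ?_⟩
      rw [mul_assoc]
      refine hLip' _ _ _ (by positivity) ?_ k
      rintro (⟨q, hq⟩ | r)
      · simp only [comb, Sum.elim_inl]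
        have h1 : -a q.2 0 * b q.1 + a q.1 0 * b q.2 - (-a q.2 0 * b' q.1 + a q.1 0 * b' q.2)
            = -a q.2 0 * (b q.1 - b' q.1) + a q.1 0 * (b q.2 - b' q.2) := by ring
        rw [h1]
        refine (abs_add_le _ _).trans ?_
        rw [abs_mul, abs_mul, abs_neg]
        have := mul_le_mul (hA q.2) (hb q.1) (abs_nonneg _) hA0
        have := mul_le_mul (hA q.1) (hb q.2) (abs_nonneg _) hA0
        nlinarith
      · simp only [comb, Sum.elim_inr]
        have := hb r.1
        nlinarith [mul_nonneg hA0 hM]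
    obtain ⟨G, hG0, hG⟩ : ∃ G : ℝ, 0 ≤ G ∧ ∀ b b' M, 0 ≤ M → (∀ r, |b r - b' r| ≤ M) →
        ∀ r, |f b r - f b' r| ≤ G * M := by
      let g (r : ι) : ℝ := (1 + ∑ k, |a r (Fin.succ k)| * D) / |a r 0|
      have hg0 : ∀ r, 0 ≤ g r := fun r => by
        have : 0 ≤ ∑ k, |a r (Fin.succ k)| * D :=
          Finset.sum_nonneg fun _ _ => mul_nonneg (abs_nonneg _) hD0
        positivity
      refine ⟨∑ r, g r, Finset.sum_nonneg fun r _ => hg0 r, fun b b' M hM hb r => ?_⟩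
      have hr : g r ≤ ∑ r, g r := Finset.single_le_sum (fun r _ => hg0 r) (Finset.mem_univ r)
      refine le_trans ?_ (mul_le_mul_of_nonneg_right hr hM)
      simp only [f, g, ← sub_div, abs_div, div_mul_eq_mul_div]
      refine div_le_div_of_nonneg_right ?_ (abs_nonneg _)
      have h1 : b r - ∑ k, a r (Fin.succ k) * Y' (comb b) k
          - (b' r - ∑ k, a r (Fin.succ k) * Y' (comb b') k)
          = (b r - b' r) - ∑ k, a r (Fin.succ k) * (Y' (comb b) k - Y' (comb b') k) := by
        simp only [mul_sub, Finset.sum_sub_distrib]; ring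
      rw [h1]
      refine (abs_sub _ _).trans ?_
      rw [add_mul, one_mul, Finset.sum_mul]
      refine add_le_add (hb r) ((Finset.abs_sum_le_sum_abs _ _).trans
        (Finset.sum_le_sum fun k _ => ?_))
      rw [abs_mul, mul_assoc]
      exact mul_le_mul_of_nonneg_left (hD b b' M hM hb k) (abs_nonneg _)
    have hy₀ : ∀ b b' M, 0 ≤ M → (∀ r, |b r - b' r| ≤ M) → y₀ b ≤ y₀ b' + G * M := by
      intro b b' M hM hb
      have h1 : ∀ r, f b r ≤ f b' r + G * M := fun r => by
        linarith [(abs_le.mp (hG b b' M hM hb r)).2]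
      simp only [y₀]
      split_ifs with h h'
      · refine Finset.sup'_le _ _ fun r hr => (h1 r).trans ?_
        gcongr
        exact Finset.le_sup' (f b') hr
      · rw [← sub_le_iff_le_add]
        refine Finset.le_inf' _ _ fun r hr => ?_
        rw [sub_le_iff_le_add]
        exact (Finset.inf'_le (f b) hr).trans (h1 r)
      · positivity
    refine ⟨fun b => Fin.cons (y₀ b) (Y' (comb b)), D + G, by positivity, ?_, ?_⟩
    · intro b b' M hM hb k
      refine Fin.cases ?_ (fun k => ?_) k
      · simp only [Fin.cons_zero]
        have h1 := hy₀ b b' M hM hb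
        have h2 := hy₀ b' b M hM fun r => by rw [abs_sub_comm]; exact hb r
        rw [abs_le]
        constructor <;> nlinarith [mul_nonneg hD0 hM]
      · simp only [Fin.cons_succ]
        refine (hD b b' M hM hb k).trans ?_
        nlinarith [mul_nonneg hG0 hM]
    · rintro b ⟨y, hy⟩ r
      have hfeas : ∀ r', ∑ k, comb (fun r => a r (Fin.succ k)) r' * Y' (comb b) k ≤ comb b r' := by
        refine hY' _ ⟨fun k => y k.succ, ?_⟩
        rintro (⟨q, hq⟩ | ⟨r, hr⟩)
        · have h1 := hy q.1
          have h2 := hy q.2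
          rw [Fin.sum_univ_succ] at h1 h2
          simp only [comb, Sum.elim_inl, add_mul, Finset.sum_add_distrib, mul_assoc,
            ← Finset.mul_sum]
          have h3 := mul_le_mul_of_nonneg_left h1 (neg_nonneg.mpr hq.2.le)
          have h4 := mul_le_mul_of_nonneg_left h2 hq.1.le
          linarith
        · have h1 := hy r
          rw [Fin.sum_univ_succ, hr] at h1
          simpa [comb] using h1
      rw [Fin.sum_univ_succ]
      simp only [Fin.cons_zero, Fin.cons_succ]
      -- The paired inequalities say exactly that every lower bound is at most every upper bound.
      have key : ∀ p q, 0 < a p 0 → a q 0 < 0 → f b q ≤ f b p := by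
        intro p q hp hq
        have h1 := hfeas (Sum.inl ⟨(p, q), hp, hq⟩)
        simp only [comb, Sum.elim_inl, add_mul, Finset.sum_add_distrib, mul_assoc,
            ← Finset.mul_sum] at h1
        simp only [f]
        rw [le_div_iff₀ hp, div_mul_eq_mul_div, div_le_iff_of_neg hq]
        simp only [comb]
        linarith
      rcases lt_trichotomy (a r 0) 0 with hr | hr | hr
      · have hmem : r ∈ neg := by simp [neg, hr]
        have h1 : f b r ≤ y₀ b := by
          simp only [y₀]
          rw [dif_pos ⟨r, hmem⟩]
          exact Finset.le_sup' (f b) hmem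
        simp only [f] at h1
        rw [div_le_iff_of_neg hr] at h1
        linarith
      · have h1 := hfeas (Sum.inr ⟨r, hr⟩)
        rw [hr]
        simpa [comb] using h1
      · have hmem : r ∈ pos := by simp [pos, hr]
        have h1 : y₀ b ≤ f b r := by
          simp only [y₀]
          split_ifs with h h'
          · exact Finset.sup'_le _ _ fun q hq => key r q hr (by simpa [neg] using hq)
          · exact Finset.inf'_le (f b) hmem
          · exact absurd ⟨r, hmem⟩ h'
        simp only [f] at h1
        rw [le_div_iff₀ hr] at h1
        linarith

end CrystalScheme

/-! ### The polar norm as the gauge of a zonotope -/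

namespace CrystalScheme
namespace Interaction
variable {N m : ℕ} (I : Interaction N m)

theorem beta_e_pos (k : Fin m) : 0 < I.β (I.e k) := (I.pos_iff _).2 ⟨k, Or.inl rfl⟩

/-- The zonotope map `y ↦ ∑_k 2 β(e_k) y_k e_k`. -/
noncomputable def zono (y : Fin m → ℝ) : Fin N → ℝ :=
  fun a => ∑ k, 2 * I.β (I.e k) * y k * (I.e k a : ℝ)

theorem zono_add (y y' : Fin m → ℝ) : I.zono (y + y') = I.zono y + I.zono y' := by
  ext a
  simp only [zono, Pi.add_apply, ← Finset.sum_add_distrib]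
  exact Finset.sum_congr rfl fun k _ => by ring

theorem zono_smul (t : ℝ) (y : Fin m → ℝ) : I.zono (t • y) = t • I.zono y := by
  ext a
  simp only [zono, Pi.smul_apply, smul_eq_mul, Finset.mul_sum]
  exact Finset.sum_congr rfl fun k _ => by ring

theorem zono_single (k : Fin m) (t : ℝ) (a : Fin N) :
    I.zono (Pi.single k t) a = 2 * I.β (I.e k) * t * (I.e k a : ℝ) := by
  classical
  rw [zono, Finset.sum_eq_single k]
  · simp
  · intro l _ hl; simp [hl]
  · simp

/-- This is where the spanning hypothesis enters. With `sum_zono_mul_le` it bounds the set whose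
supremum defines φ°, so that `sSup` does not take its default value. -/
theorem zono_surjective (x : Fin N → ℝ) : ∃ y, x = I.zono y := by
  have hx : x ∈ Submodule.span ℝ (Set.range fun k : Fin m => fun a : Fin N => (I.e k a : ℝ)) := by
    rw [I.span_e]; trivial
  obtain ⟨c, hc⟩ := (Submodule.mem_span_range_iff_exists_fun ℝ).1 hx
  refine ⟨fun k => c k / (2 * I.β (I.e k)), ?_⟩
  ext a
  rw [← hc, zono, Finset.sum_apply]
  refine Finset.sum_congr rfl fun k _ => ?_
  have := I.beta_e_pos k
  simp only [Pi.smul_apply, smul_eq_mul]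
  field_simp

theorem sum_zono_mul (y : Fin m → ℝ) (v : Fin N → ℝ) :
    ∑ a, I.zono y a * v a = ∑ k, 2 * I.β (I.e k) * (y k * ∑ a, v a * (I.e k a : ℝ)) := by
  simp only [zono, Finset.sum_mul, Finset.mul_sum]
  rw [Finset.sum_comm]
  exact Finset.sum_congr rfl fun k _ => Finset.sum_congr rfl fun a _ => by ring

theorem sum_zono_mul_le {y : Fin m → ℝ} {ρ : ℝ} (hy : ∀ k, |y k| ≤ ρ) (v : Fin N → ℝ) :
    ∑ a, I.zono y a * v a ≤ ρ * I.phi v := by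
  rw [sum_zono_mul, phi, Finset.mul_sum]
  refine Finset.sum_le_sum fun k _ => ?_
  have h1 : y k * ∑ a, v a * (I.e k a : ℝ) ≤ ρ * |∑ a, v a * (I.e k a : ℝ)| :=
    (le_abs_self _).trans (by rw [abs_mul]; exact mul_le_mul_of_nonneg_right (hy k) (abs_nonneg _))
  have := I.beta_e_pos k
  nlinarith

theorem phi_nonneg (v : Fin N → ℝ) : 0 ≤ I.phi v :=
  Finset.sum_nonneg fun k _ => mul_nonneg (by linarith [I.beta_e_pos k]) (abs_nonneg _)

theorem phi_smul {t : ℝ} (ht : 0 ≤ t) (v : Fin N → ℝ) : I.phi (t • v) = t * I.phi v := by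
  rw [phi, phi, Finset.mul_sum]
  refine Finset.sum_congr rfl fun k _ => ?_
  simp only [Pi.smul_apply, smul_eq_mul, mul_assoc, ← Finset.mul_sum, abs_mul, abs_of_nonneg ht]
  ring

theorem phiPolar_zono_le {y : Fin m → ℝ} {ρ : ℝ} (hρ : 0 ≤ ρ) (hy : ∀ k, |y k| ≤ ρ) :
    I.phiPolar (I.zono y) ≤ ρ := by
  refine csSup_le ⟨0, 0, ?_, by simp⟩ ?_
  · simp [phi]
  · rintro s ⟨v, hv, rfl⟩
    have := I.sum_zono_mul_le hy v
    nlinarith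

theorem exists_abs_le (y : Fin m → ℝ) : ∃ ρ : ℝ, 0 ≤ ρ ∧ ∀ k, |y k| ≤ ρ :=
  ⟨∑ k, |y k|, Finset.sum_nonneg fun _ _ => abs_nonneg _, fun k =>
    Finset.single_le_sum (f := fun k => |y k|) (fun _ _ => abs_nonneg _) (Finset.mem_univ k)⟩

theorem sum_mul_le_phiPolar (x v : Fin N → ℝ) : ∑ a, x a * v a ≤ I.phiPolar x * I.phi v := by
  obtain ⟨y, rfl⟩ := I.zono_surjective x
  obtain ⟨ρ, hρ, hy⟩ := exists_abs_le y
  -- If φ(v) = 0 then `v` cannot be normalized, but the zonotope representation already makes the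
  -- pairing nonpositive.
  rcases (I.phi_nonneg v).eq_or_lt with h0 | hpos
  · have := I.sum_zono_mul_le hy v
    rw [← h0] at this ⊢
    simpa using this
  · have h1 : ∑ a, I.zono y a * ((I.phi v)⁻¹ • v) a ≤ I.phiPolar (I.zono y) := by
      refine le_csSup ⟨ρ, ?_⟩ ⟨(I.phi v)⁻¹ • v, ?_, rfl⟩
      · rintro s ⟨v, hv, rfl⟩
        have := I.sum_zono_mul_le hy v
        nlinarith
      · rw [I.phi_smul (by positivity), inv_mul_cancel₀ hpos.ne']
    have h2 : ∑ a, I.zono y a * ((I.phi v)⁻¹ • v) a = (∑ a, I.zono y a * v a) / I.phi v := by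
      rw [Finset.sum_div]
      exact Finset.sum_congr rfl fun a _ => by simp only [Pi.smul_apply, smul_eq_mul]; field_simp
    rwa [h2, div_le_iff₀ hpos] at h1

theorem phiPolar_nonneg (x : Fin N → ℝ) : 0 ≤ I.phiPolar x := by
  obtain ⟨y, rfl⟩ := I.zono_surjective x
  obtain ⟨ρ, hρ, hy⟩ := exists_abs_le y
  refine le_csSup ⟨ρ, ?_⟩ ⟨0, by simp [phi], by simp⟩
  rintro s ⟨v, hv, rfl⟩
  have := I.sum_zono_mul_le hy v
  nlinarith

/-- The unit ball of `φ°` is the zonotope `{∑_k 2 β(e_k) y_k e_k : |y_k| ≤ 1}`. -/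
theorem exists_zono_eq (x : Fin N → ℝ) : ∃ y, I.zono y = x ∧ ∀ k, |y k| ≤ I.phiPolar x := by
  classical
  set ρ := I.phiPolar x with hρ
  have hρ0 : 0 ≤ ρ := I.phiPolar_nonneg x
  let A : (Fin m → ℝ) →ₗ[ℝ] (Fin N → ℝ) :=
    { toFun := I.zono, map_add' := I.zono_add, map_smul' := I.zono_smul }
  have hA : Continuous A := A.continuous_of_finiteDimensional
  have hmem : ∀ y : Fin m → ℝ, y ∈ Metric.closedBall (0 : Fin m → ℝ) ρ ↔ ∀ k, |y k| ≤ ρ := by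
    intro y
    simp [pi_norm_le_iff_of_nonneg hρ0]
  have hcomp : IsCompact (A '' Metric.closedBall 0 ρ) := (isCompact_closedBall _ _).image hA
  have hconv : Convex ℝ (A '' Metric.closedBall 0 ρ) := (convex_closedBall _ _).linear_image A
  by_contra hne
  push Not at hne
  have hx : x ∉ A '' Metric.closedBall 0 ρ := by
    rintro ⟨y, hy, hyx⟩
    obtain ⟨k, hk⟩ := hne y hyx
    exact absurd ((hmem y).1 hy k) (not_le.mpr hk)
  obtain ⟨f, c, hf, hfx⟩ := geometric_hahn_banach_closed_point hconv hcomp.isClosed hx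
  let v : Fin N → ℝ := fun a => f (Pi.single a 1)
  have hfv : ∀ x : Fin N → ℝ, f x = ∑ a, x a * v a := by
    intro x
    conv_lhs => rw [pi_eq_sum_univ' x]
    rw [map_sum]
    refine Finset.sum_congr rfl fun a _ => ?_
    rw [map_smul, smul_eq_mul]
  -- A point of the box maximizing the pairing with `v`, with value ρ φ(v). Separation would thus
  -- give x · v > φ°(x) φ(v).
  let y : Fin m → ℝ := fun k => ρ * SignType.sign (∑ a, v a * (I.e k a : ℝ))
  have hy : ∀ k, |y k| ≤ ρ := by
    intro k
    simp only [y, abs_mul, abs_of_nonneg hρ0]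
    refine mul_le_of_le_one_right hρ0 ?_
    rcases SignType.sign (∑ a, v a * (I.e k a : ℝ)) <;> simp
  have h1 := hf _ ⟨y, (hmem y).2 hy, rfl⟩
  have h2 : f (A y) = ρ * I.phi v := by
    rw [hfv]
    refine (I.sum_zono_mul y v).trans ?_
    rw [phi, Finset.mul_sum]
    refine Finset.sum_congr rfl fun k _ => ?_
    rw [← sign_mul_self (∑ a, v a * (I.e k a : ℝ))]
    simp only [y]
    ring
  have h3 := I.sum_mul_le_phiPolar x v
  rw [← hfv] at h3
  linarith

theorem phiPolar_add_le (x x' : Fin N → ℝ) :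
    I.phiPolar (x + x') ≤ I.phiPolar x + I.phiPolar x' := by
  obtain ⟨y, hy, hyk⟩ := I.exists_zono_eq x
  obtain ⟨y', hy', hyk'⟩ := I.exists_zono_eq x'
  have := I.phiPolar_zono_le (y := y + y') (ρ := I.phiPolar x + I.phiPolar x')
    (add_nonneg (I.phiPolar_nonneg _) (I.phiPolar_nonneg _))
    (fun k => (abs_add_le _ _).trans (add_le_add (hyk k) (hyk' k)))
  rwa [zono_add, hy, hy'] at this

theorem phiPolar_smul_le (t : ℝ) (x : Fin N → ℝ) : I.phiPolar (t • x) ≤ |t| * I.phiPolar x := by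
  obtain ⟨y, hy, hyk⟩ := I.exists_zono_eq x
  have := I.phiPolar_zono_le (y := t • y) (ρ := |t| * I.phiPolar x)
    (mul_nonneg (abs_nonneg _) (I.phiPolar_nonneg _))
    (fun k => by
      rw [Pi.smul_apply, smul_eq_mul, abs_mul]
      exact mul_le_mul_of_nonneg_left (hyk k) (abs_nonneg _))
  rwa [zono_smul, hy] at this

theorem phiPolar_neg (x : Fin N → ℝ) : I.phiPolar (-x) = I.phiPolar x := by
  have h : ∀ x, I.phiPolar (-x) ≤ I.phiPolar x := fun x => by
    simpa using I.phiPolar_smul_le (-1) x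
  exact le_antisymm (h x) (by simpa using h (-x))

theorem phiPolar_zero : I.phiPolar 0 = 0 :=
  le_antisymm (by simpa using I.phiPolar_smul_le 0 0) (I.phiPolar_nonneg 0)

theorem phiPolar_sub_comm (x x' : Fin N → ℝ) : I.phiPolar (x - x') = I.phiPolar (x' - x) := by
  rw [← I.phiPolar_neg, neg_sub]

theorem phiPolar_le_add_sub (x x' : Fin N → ℝ) :
    I.phiPolar x ≤ I.phiPolar x' + I.phiPolar (x - x') := by
  simpa using I.phiPolar_add_le x' (x - x')

theorem exists_phiPolar_le :
    ∃ C : ℝ, 0 < C ∧ ∀ (x : Fin N → ℝ) (M : ℝ), (∀ a, |x a| ≤ M) → 0 ≤ M →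
      I.phiPolar x ≤ C * M := by
  classical
  refine ⟨1 + ∑ a : Fin N, I.phiPolar (Pi.single a 1), ?_, fun x M hx hM => ?_⟩
  · have : 0 ≤ ∑ a : Fin N, I.phiPolar (Pi.single a 1) :=
      Finset.sum_nonneg fun _ _ => I.phiPolar_nonneg _
    linarith
  · have h : ∀ s : Finset (Fin N), I.phiPolar (∑ a ∈ s, x a • Pi.single a (1 : ℝ)) ≤
        ∑ a ∈ s, M * I.phiPolar (Pi.single a 1) := by
      intro s
      induction s using Finset.induction_on with
      | empty => simp [phiPolar_zero]
      | insert a s ha ih =>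
        rw [Finset.sum_insert ha, Finset.sum_insert ha]
        refine (I.phiPolar_add_le _ _).trans (add_le_add ?_ ih)
        exact (I.phiPolar_smul_le _ _).trans
          (mul_le_mul_of_nonneg_right (hx a) (I.phiPolar_nonneg _))
    have h1 := h Finset.univ
    rw [← pi_eq_sum_univ' x, ← Finset.mul_sum] at h1
    linarith

theorem finite_phiPolar_point_le {ε : ℝ} (hε : 0 < ε) (M : ℝ) :
    {i : Fin N → ℤ | I.phiPolar (point ε i) ≤ M}.Finite := by
  let D : Fin N → ℝ := fun a => ∑ k, 2 * I.β (I.e k) * |(I.e k a : ℝ)|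
  refine (Set.finite_Icc (fun a => -⌈M * D a / ε⌉) (fun a => ⌈M * D a / ε⌉)).subset ?_
  intro i hi
  obtain ⟨y, hy, hyk⟩ := I.exists_zono_eq (point ε i)
  have h : ∀ a, |(i a : ℝ)| ≤ M * D a / ε := by
    intro a
    rw [le_div_iff₀ hε, mul_comm, ← abs_of_pos hε, ← abs_mul]
    change |point ε i a| ≤ _
    rw [← hy, zono, Finset.mul_sum]
    refine (Finset.abs_sum_le_sum_abs _ _).trans (Finset.sum_le_sum fun k _ => ?_)
    have hb := I.beta_e_pos k
    rw [abs_mul, abs_mul, abs_of_pos (by linarith : 0 < 2 * I.β (I.e k))]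
    have := mul_le_mul_of_nonneg_right ((hyk k).trans hi)
      (mul_nonneg (by linarith : 0 ≤ 2 * I.β (I.e k)) (abs_nonneg (I.e k a : ℝ)))
    linarith
  have h' : ∀ a, |i a| ≤ ⌈M * D a / ε⌉ := by
    intro a
    have := (h a).trans (Int.le_ceil _)
    exact_mod_cast this
  exact ⟨fun a => (abs_le.1 (h' a)).1, fun a => (abs_le.1 (h' a)).2⟩

/-- A Lipschitz choice of coefficients realizing `φ°`. -/
theorem exists_lipschitz_zono :
    ∃ (Y : (Fin N → ℝ) → Fin m → ℝ) (C : ℝ), 0 ≤ C ∧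
      (∀ x, I.zono (Y x) = x) ∧ (∀ x k, |Y x k| ≤ I.phiPolar x) ∧
      ∀ x x' M, 0 ≤ M → (∀ a, |x a - x' a| ≤ M) → ∀ k, |Y x k - Y x' k| ≤ C * M := by
  classical
  -- The equation is split into opposite inequalities. The point `x` enters only through the
  -- right-hand side, which is Lipschitz in `x`, so the selection theorem applies with a fixed
  -- matrix.
  let a : (Fin N ⊕ Fin N) ⊕ (Fin m ⊕ Fin m) → Fin m → ℝ :=
    Sum.elim (Sum.elim (fun c k => 2 * I.β (I.e k) * (I.e k c : ℝ))
        (fun c k => -(2 * I.β (I.e k) * (I.e k c : ℝ))))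
      (Sum.elim (fun l k => if k = l then 1 else 0) (fun l k => if k = l then -1 else 0))
  let b : (Fin N → ℝ) → (Fin N ⊕ Fin N) ⊕ (Fin m ⊕ Fin m) → ℝ := fun x =>
    Sum.elim (Sum.elim x (-x)) (fun _ => I.phiPolar x)
  have hz : ∀ y c, ∑ k, 2 * I.β (I.e k) * (I.e k c : ℝ) * y k = I.zono y c := fun y c =>
    Finset.sum_congr rfl fun k _ => by ring
  have hsys : ∀ x (y : Fin m → ℝ), (∀ r, ∑ k, a r k * y k ≤ b x r) ↔
      I.zono y = x ∧ ∀ k, |y k| ≤ I.phiPolar x := by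
    intro x y
    simp only [a, b, Sum.forall, Sum.elim_inl, Sum.elim_inr, ite_mul, one_mul, zero_mul, neg_mul,
      Finset.sum_ite_eq', Finset.mem_univ, if_true, Pi.neg_apply, Finset.sum_neg_distrib, hz,
      neg_le_neg_iff, funext_iff, abs_le]
    constructor
    · rintro ⟨⟨h1, h2⟩, h3, h4⟩
      exact ⟨fun c => le_antisymm (h1 c) (h2 c), fun k => ⟨by linarith [h4 k], h3 k⟩⟩
    · rintro ⟨h1, h2⟩
      exact ⟨⟨fun c => (h1 c).le, fun c => (h1 c).ge⟩, fun k => (h2 k).2,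
        fun k => by linarith [(h2 k).1]⟩
  obtain ⟨Y, C, hC, hLip, hY⟩ := exists_lipschitz_selection m _ a
  have hsol : ∀ x, I.zono (Y (b x)) = x ∧ ∀ k, |Y (b x) k| ≤ I.phiPolar x := by
    intro x
    rw [← hsys]
    obtain ⟨y, hy⟩ := I.exists_zono_eq x
    exact hY (b x) ⟨y, (hsys x y).2 hy⟩
  obtain ⟨D, hD, hDx⟩ := I.exists_phiPolar_le
  refine ⟨fun x => Y (b x), C * (1 + D), by positivity, fun x => (hsol x).1,
    fun x => (hsol x).2, fun x x' M hM hx k => ?_⟩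
  have hP : |I.phiPolar x - I.phiPolar x'| ≤ D * M := by
    have h0 := hDx (x - x') M hx hM
    have h1 := I.phiPolar_le_add_sub x x'
    have h2 := I.phiPolar_le_add_sub x' x
    rw [I.phiPolar_sub_comm x' x] at h2
    rw [abs_le]
    constructor <;> linarith
  have hDM : 0 ≤ D * M := by positivity
  rw [mul_assoc]
  refine hLip _ _ _ (by positivity) ?_ k
  rintro ((c | c) | l)
  · simp only [b, Sum.elim_inl]
    linarith [hx c]
  · simp only [b, Sum.elim_inl, Sum.elim_inr, Pi.neg_apply, neg_sub_neg]
    rw [abs_sub_comm]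
    linarith [hx c]
  · simp only [b, Sum.elim_inr]
    linarith

end Interaction
end CrystalScheme

/-! ### Calibration, comparison and one variational step -/

namespace CrystalScheme

theorem tsum_sum_ite_sub_ite {ι κ : Type*} [Fintype κ] [DecidableEq ι] (a b : κ → ι) (F G : κ → ℝ)
    (ε : ℝ) : ∑' j, ∑ k, ((if j = a k then F k else 0) - (if j = b k then G k else 0)) / ε =
      ∑ k, (F k - G k) / ε :=
  (hasSum_sum fun k _ =>
    ((hasSum_ite_eq (a k) (F k)).sub (hasSum_ite_eq (b k) (G k))).div_const ε).tsum_eq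

namespace Interaction
variable {N m : ℕ} (I : Interaction N m)

/-- If y_k were not saturated, mixing `y` slightly with a representation of the closer point,
corrected by τ in coordinate k, would represent the same point with all coefficients strictly below
φ°. This contradicts the minimality of φ°. -/
theorem coeff_eq_of_phiPolar_lt {y : Fin m → ℝ} {k : Fin m} {τ : ℝ} (hτ : 0 < τ)
    (hy : ∀ l, |y l| ≤ I.phiPolar (I.zono y))
    (hlt : I.phiPolar (I.zono y - I.zono (Pi.single k τ)) < I.phiPolar (I.zono y)) :
    y k = I.phiPolar (I.zono y) := by
  classical
  obtain ⟨y', hy', hyk'⟩ := I.exists_zono_eq (I.zono y - I.zono (Pi.single k τ))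
  set ρ := I.phiPolar (I.zono y)
  set ρ' := I.phiPolar (I.zono y - I.zono (Pi.single k τ))
  have hρ' : 0 ≤ ρ' := I.phiPolar_nonneg _
  by_contra hne
  have hk : 0 < ρ - y k := sub_pos.2 (lt_of_le_of_ne (abs_le.1 (hy k)).2 hne)
  have hk2 := abs_le.1 (hy k)
  have hk3 := abs_le.1 (hyk' k)
  -- The mixing weight (ρ − y_k)/D must be at most 1 and must keep coordinate k, which grows by at
  -- most weight · (τ + 2ρ), below ρ.
  set D := 3 * ρ + τ + 1
  have hD : 0 < D := by simp only [D]; linarith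
  set lam := (ρ - y k) / D
  have hlam : 0 < lam := by positivity
  have hlam1 : lam ≤ 1 := by rw [div_le_one hD]; simp only [D]; linarith
  have hlamD : lam * D = ρ - y k := by simp only [lam]; field_simp
  let Y : Fin m → ℝ := (1 - lam) • y + lam • (y' + Pi.single k τ)
  have hY : I.zono Y = I.zono y := by
    simp only [Y, zono_add, zono_smul, hy']
    rw [sub_add_cancel, ← add_smul, sub_add_cancel, one_smul]
  have h1 : (1 - lam) * ρ + lam * ρ' < ρ := by nlinarith
  have h2 : y k + lam * (τ + 2 * ρ) < ρ := by simp only [D] at hlamD; nlinarith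
  have hmax : max ((1 - lam) * ρ + lam * ρ') (y k + lam * (τ + 2 * ρ)) < ρ := max_lt h1 h2
  refine absurd (I.phiPolar_zono_le (y := Y)
    (ρ := max ((1 - lam) * ρ + lam * ρ') (y k + lam * (τ + 2 * ρ)))
    (le_max_of_le_left ?_) fun l => ?_) (not_le.2 ?_)
  · have : 0 ≤ ρ := hρ'.trans hlt.le
    have := sub_nonneg.2 hlam1
    positivity
  · by_cases hl : l = k
    · subst hl
      simp only [Y, Pi.add_apply, Pi.smul_apply, Pi.single_eq_same, smul_eq_mul]
      rw [abs_le]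
      constructor
      · refine (neg_le_neg (le_max_left _ _)).trans ?_
        nlinarith
      · refine le_trans ?_ (le_max_right _ _)
        nlinarith
    · simp only [Y, Pi.add_apply, Pi.smul_apply, Pi.single_eq_of_ne hl, smul_eq_mul, add_zero]
      refine le_trans ((abs_add_le _ _).trans ?_) (le_max_left _ _)
      rw [abs_mul, abs_mul, abs_of_pos hlam, abs_of_nonneg (sub_nonneg.2 hlam1)]
      exact add_le_add (mul_le_mul_of_nonneg_left (hy l) (sub_nonneg.2 hlam1))
        (mul_le_mul_of_nonneg_left (hyk' l) hlam.le)
  · rwa [hY]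

theorem point_sub (ε : ℝ) (i j : Fin N → ℤ) : point ε (i - j) = point ε i - point ε j := by
  ext a; simp [point, mul_sub]

theorem point_e (ε : ℝ) (k : Fin m) :
    point ε (I.e k) = I.zono (Pi.single k (ε / (2 * I.β (I.e k)))) := by
  ext a
  rw [zono_single, point]
  have := I.beta_e_pos k
  field_simp

theorem coeff_eq_of_sub_e {ε : ℝ} (hε : 0 < ε) {y : Fin m → ℝ} {i : Fin N → ℤ} {k : Fin m}
    (hz : I.zono y = point ε i) (hy : ∀ l, |y l| ≤ I.phiPolar (point ε i))
    (hlt : I.phiPolar (point ε (i - I.e k)) < I.phiPolar (point ε i)) :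
    y k = I.phiPolar (point ε i) := by
  have := I.beta_e_pos k
  rw [← hz] at hy ⊢
  rw [point_sub, point_e, ← hz] at hlt
  exact I.coeff_eq_of_phiPolar_lt (by positivity) hy hlt

theorem coeff_eq_of_add_e {ε : ℝ} (hε : 0 < ε) {y : Fin m → ℝ} {i : Fin N → ℤ} {k : Fin m}
    (hz : I.zono y = point ε i) (hy : ∀ l, |y l| ≤ I.phiPolar (point ε i))
    (hlt : I.phiPolar (point ε (i + I.e k)) < I.phiPolar (point ε i)) :
    y k = -I.phiPolar (point ε i) := by
  have hneg : ∀ j : Fin N → ℤ, point ε (-j) = -point ε j := fun j => by ext a; simp [point]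
  have h1 : I.phiPolar (point ε (-i)) = I.phiPolar (point ε i) := by rw [hneg, phiPolar_neg]
  have h2 := I.coeff_eq_of_sub_e hε (y := -y) (i := -i) (k := k)
    (by rw [hneg, ← hz, ← neg_one_smul ℝ y, zono_smul, neg_one_smul])
    (fun l => by rw [h1, Pi.neg_apply, abs_neg]; exact hy l)
    (by rw [h1, ← neg_add', hneg, phiPolar_neg]; exact hlt)
  rw [h1, Pi.neg_apply] at h2
  linarith

/-- The truncated Wulff distance `max (φ°) r` on the lattice. -/
noncomputable def radial (ε r : ℝ) (i : Fin N → ℤ) : ℝ := max (I.phiPolar (point ε i)) r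

theorem finite_support_beta : (Function.support I.β).Finite := by
  refine ((Set.finite_range I.e).union (Set.finite_range fun k => -I.e k)).subset fun d hd => ?_
  obtain ⟨k, hk | hk⟩ := (I.pos_iff d).1 (lt_of_le_of_ne (I.nonneg d) (Ne.symm hd))
  exacts [Or.inl ⟨k, hk.symm⟩, Or.inr ⟨k, hk.symm⟩]

theorem beta_sub_comm (i j : Fin N → ℤ) : I.β (i - j) = I.β (j - i) := by
  rw [← I.even, neg_sub]

theorem hasSum_beta_sub (i : Fin N → ℤ) : HasSum (fun j => I.β (i - j)) (∑' d, I.β d) :=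
  (Equiv.subLeft i).hasSum_iff.2 (summable_of_hasFiniteSupport I.finite_support_beta).hasSum

section
variable {z : (Fin N → ℤ) → (Fin N → ℤ) → ℝ} (hz : ∀ i j, |z i j| ≤ I.β (i - j))
include hz

theorem abs_adjGrad_term_le {ε : ℝ} (hε : 0 < ε) (i j : Fin N → ℤ) :
    ‖(z i j - z j i) / ε‖ ≤ 2 / ε * I.β (i - j) := by
  rw [Real.norm_eq_abs, abs_div, abs_of_pos hε, div_mul_eq_mul_div]
  refine div_le_div_of_nonneg_right ?_ hε.le
  have h1 := hz i j
  have h2 := hz j i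
  rw [I.beta_sub_comm] at h2
  linarith [abs_sub (z i j) (z j i)]

theorem summable_adjGrad {ε : ℝ} (hε : 0 < ε) (i : Fin N → ℤ) :
    Summable fun j => (z i j - z j i) / ε :=
  Summable.of_norm_bounded ((I.hasSum_beta_sub i).summable.mul_left (2 / ε))
    (I.abs_adjGrad_term_le hz hε i)

/-- This bound degenerates as ε → 0. It serves only for qualitative facts: finiteness of a contact
set and lower bounds with unspecified constants. -/
theorem abs_adjGrad_le {ε : ℝ} (hε : 0 < ε) (i : Fin N → ℤ) :
    |adjGrad ε z i| ≤ 2 / ε * ∑' d, I.β d :=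
  tsum_of_norm_bounded ((I.hasSum_beta_sub i).mul_left (2 / ε)) (I.abs_adjGrad_term_le hz hε i)

end

theorem SolvesROF.eq_beta {ε h : ℝ} {g u : (Fin N → ℤ) → ℝ} {z : (Fin N → ℤ) → (Fin N → ℤ) → ℝ}
    {I : Interaction N m} (H : I.SolvesROF ε h g u z) {i j : Fin N → ℤ} (hij : u j < u i) :
    z i j = I.β (i - j) ∧ z j i = -I.β (i - j) := by
  have h1 := H.calibrates i j
  have h2 := H.calibrates j i
  rw [abs_of_pos (sub_pos.2 hij)] at h1
  rw [abs_of_neg (sub_neg.2 hij), ← I.beta_sub_comm] at h2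
  refine ⟨mul_right_cancel₀ (sub_pos.2 hij).ne' h1, mul_right_cancel₀ (sub_neg.2 hij).ne ?_⟩
  rw [h2]; ring

/-- Comparison with a supersolution `w` which lies above `u` outside a finite set. -/
theorem SolvesROF.le_of_supersolution {ε h : ℝ} {g u w : (Fin N → ℤ) → ℝ}
    {z z' : (Fin N → ℤ) → (Fin N → ℤ) → ℝ} {I : Interaction N m} (H : I.SolvesROF ε h g u z)
    (hε : 0 < ε) (hh : 0 < h) (hz' : ∀ i j, |z' i j| ≤ I.β (i - j))
    (hcal : ∀ i j, w j < w i → z' i j = I.β (i - j) ∧ z' j i = -I.β (i - j))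
    (hsup : ∀ i, g i ≤ h * adjGrad ε z' i + w i) (hfin : {i | w i < u i}.Finite) (i) :
    u i ≤ w i := by
  classical
  by_contra hi
  let A := hfin.toFinset
  have hA : ∀ i, i ∈ A ↔ w i < u i := fun i => by simp [A]
  -- The divergences are compared by summing over the set {w < u}: the equations make the sum
  -- negative, while interior edges cancel and boundary edges contribute nonnegative terms.
  let q : (Fin N → ℤ) → (Fin N → ℤ) → ℝ := fun i j => (z i j - z j i) / ε - (z' i j - z' j i) / ε
  have hq : ∀ i, Summable (q i) := fun i =>
    (I.summable_adjGrad H.bound hε i).sub (I.summable_adjGrad hz' hε i)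
  have hqs : ∀ i, ∑' j, q i j = adjGrad ε z i - adjGrad ε z' i := fun i =>
    (I.summable_adjGrad H.bound hε i).tsum_sub (I.summable_adjGrad hz' hε i)
  have hneg : ∀ i ∈ A, ∑' j, q i j < 0 := by
    intro i hi
    rw [hA] at hi
    rw [hqs]
    have h1 := H.eq i
    have h2 := hsup i
    by_contra h3
    have := mul_nonneg hh.le (not_lt.1 h3)
    nlinarith
  have hpos : ∀ i ∈ A, ∀ j ∉ A, 0 ≤ q i j := by
    intro i hi j hj
    rw [hA] at hi hj
    have hb1 := abs_le.1 (H.bound i j)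
    have hb2 := abs_le.1 (H.bound j i)
    have hb3 := abs_le.1 (hz' i j)
    have hb4 := abs_le.1 (hz' j i)
    rw [← I.beta_sub_comm] at hb2 hb4
    simp only [q]
    rw [← sub_div]
    refine div_nonneg ?_ hε.le
    -- Either w increases from `i` to `j` and `z'` takes its extreme value, or u_i > w_i ≥ w_j ≥ u_j
    -- and `z` does.
    rcases lt_or_ge (w i) (w j) with hw | hw
    · obtain ⟨e1, e2⟩ := hcal j i hw
      rw [I.beta_sub_comm] at e1 e2
      linarith
    · obtain ⟨e1, e2⟩ := H.eq_beta (show u j < u i by linarith)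
      linarith
  have hS : ∑ i ∈ A, ∑ j ∈ A, q i j = 0 := by
    have h1 : ∑ i ∈ A, ∑ j ∈ A, q i j = -∑ i ∈ A, ∑ j ∈ A, q i j := by
      conv_lhs => rw [Finset.sum_comm]
      simp only [← Finset.sum_neg_distrib]
      refine Finset.sum_congr rfl fun i _ => Finset.sum_congr rfl fun j _ => ?_
      simp only [q]; ring
    linarith
  have h1 : ∑ i ∈ A, ∑ j ∈ A, q i j ≤ ∑ i ∈ A, ∑' j, q i j :=
    Finset.sum_le_sum fun i hi => (hq i).sum_le_tsum A fun j hj => hpos i hi j hj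
  have h2 : ∑ i ∈ A, ∑' j, q i j < ∑ i ∈ A, (0 : ℝ) :=
    Finset.sum_lt_sum_of_nonempty ⟨i, (hA i).2 (not_le.1 hi)⟩ hneg
  simp only [Finset.sum_const_zero] at h2
  linarith

set_option maxHeartbeats 1000000 in
/-- The discrete calibration of `max (φ°) r`, with divergence bounded by `C / r`. -/
theorem exists_calibration : ∃ C : ℝ, 0 ≤ C ∧ ∀ ε r : ℝ, 0 < ε → 0 < r →
    ∃ z : (Fin N → ℤ) → (Fin N → ℤ) → ℝ, (∀ i j, |z i j| ≤ I.β (i - j)) ∧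
      (∀ i j, I.radial ε r j < I.radial ε r i → z i j = I.β (i - j) ∧ z j i = -I.β (i - j)) ∧
      ∀ i, |adjGrad ε z i| ≤ C / r := by
  classical
  obtain ⟨Y, C₁, hC₁, hY, hYle, hLip⟩ := I.exists_lipschitz_zono
  obtain ⟨D, hD, hDx⟩ := I.exists_phiPolar_le
  let B : ℝ := ∑ k, ∑ a, |(I.e k a : ℝ)|
  have hB : 0 ≤ B := Finset.sum_nonneg fun _ _ => Finset.sum_nonneg fun _ _ => abs_nonneg _
  have heB : ∀ k a, |(I.e k a : ℝ)| ≤ B := fun k a =>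
    (Finset.single_le_sum (f := fun a => |(I.e k a : ℝ)|) (fun _ _ => abs_nonneg _)
      (Finset.mem_univ a)).trans
    (Finset.single_le_sum (f := fun k => ∑ a, |(I.e k a : ℝ)|)
      (fun _ _ => Finset.sum_nonneg fun _ _ => abs_nonneg _) (Finset.mem_univ k))
  refine ⟨∑ k, 4 * I.β (I.e k) * ((C₁ + D) * B),
    Finset.sum_nonneg fun k _ => mul_nonneg (by linarith [I.beta_e_pos k]) (by positivity),
    fun ε r hε hr => ?_⟩
  let ζ (k : Fin m) (i : Fin N → ℤ) : ℝ := Y (point ε i) k / I.radial ε r i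
  have hrad : ∀ i, 0 < I.radial ε r i := fun i => hr.trans_le (le_max_right _ _)
  have hYr : ∀ i k, |Y (point ε i) k| ≤ I.radial ε r i := fun i k =>
    (hYle _ k).trans (le_max_left _ _)
  have hζ1 : ∀ k i, |ζ k i| ≤ 1 := fun k i => by
    simp only [ζ]
    rw [abs_div, abs_of_pos (hrad i), div_le_one (hrad i)]
    exact hYr i k
  have hζLip : ∀ k i j M, 0 ≤ M → (∀ a, |point ε i a - point ε j a| ≤ M) →
      |ζ k i - ζ k j| ≤ (C₁ + D) * M / r := by
    intro k i j M hM hij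
    have h1 := hLip _ _ M hM hij k
    have h2 : |I.radial ε r i - I.radial ε r j| ≤ D * M := by
      have h0 := hDx (point ε i - point ε j) M hij hM
      have h1 := I.phiPolar_le_add_sub (point ε i) (point ε j)
      have h2 := I.phiPolar_le_add_sub (point ε j) (point ε i)
      rw [I.phiPolar_sub_comm (point ε j)] at h2
      refine (abs_max_sub_max_le_abs _ _ _).trans ?_
      rw [abs_le]
      constructor <;> linarith
    have h3 : ζ k i - ζ k j = ((Y (point ε i) k - Y (point ε j) k)
        - ζ k j * (I.radial ε r i - I.radial ε r j)) / I.radial ε r i := by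
      have := (hrad i).ne'
      have := (hrad j).ne'
      simp only [ζ]
      field_simp
      ring
    have h4 : |ζ k j * (I.radial ε r i - I.radial ε r j)| ≤ D * M := by
      rw [abs_mul]
      nlinarith [hζ1 k j, abs_nonneg (I.radial ε r i - I.radial ε r j), abs_nonneg (ζ k j)]
    rw [h3, abs_div, abs_of_pos (hrad i)]
    refine div_le_div₀ (by positivity) ((abs_sub _ _).trans ?_) hr (le_max_right _ _)
    linarith
  -- Each edge uses ζ at its endpoint with the larger φ°, where the coefficient is saturated. On
  -- ties `up i j` and `up j i` may differ; this is harmless, since calibration is required only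
  -- across strict inequalities.
  let up (i j : Fin N → ℤ) : Fin N → ℤ :=
    if I.phiPolar (point ε j) ≤ I.phiPolar (point ε i) then i else j
  have hup : ∀ i j, up i j = i ∨ up i j = j := fun i j => by
    simp only [up]; split_ifs <;> simp
  -- Written as a difference so that a possible vector e_k = 0 contributes nothing.
  let s (k : Fin m) (d : Fin N → ℤ) : ℝ := (if d = I.e k then 1 else 0) - if d = -I.e k then 1 else 0
  let z (i j : Fin N → ℤ) : ℝ := ∑ k, s k (i - j) * (I.β (I.e k) * ζ k (up i j))
  have hz0 : ∀ i j, (¬ ∃ k, i - j = I.e k ∨ i - j = -I.e k) → z i j = 0 := by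
    intro i j hij
    push Not at hij
    exact Finset.sum_eq_zero fun k _ => by simp [s, (hij k).1, (hij k).2]
  have hz1 : ∀ i j k, i - j = I.e k ∨ i - j = -I.e k →
      z i j = s k (i - j) * (I.β (I.e k) * ζ k (up i j)) := by
    intro i j k hij
    refine Finset.sum_eq_single k (fun l _ hl => ?_) (by simp)
    have h1 := I.distinct l k hl
    have h2 : i - j ≠ I.e l := by
      rcases hij with h | h <;> rw [h]
      exacts [h1.1.symm, h1.2.symm]
    have h3 : i - j ≠ -I.e l := by
      rcases hij with h | h <;> rw [h]
      · intro h; exact h1.2 (by rw [h, neg_neg])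
      · intro h; exact h1.1 (neg_injective h.symm)
    simp [s, h2, h3]
  have hs : ∀ k d, |s k d| ≤ 1 := fun k d => by
    simp only [s]; split_ifs <;> norm_num
  have hbound : ∀ i j, |z i j| ≤ I.β (i - j) := by
    intro i j
    by_cases hij : ∃ k, i - j = I.e k ∨ i - j = -I.e k
    · obtain ⟨k, hk⟩ := hij
      have hβ : I.β (i - j) = I.β (I.e k) := by
        rcases hk with h | h <;> rw [h]
        exact I.even _
      have hb := I.beta_e_pos k
      rw [hz1 i j k hk, hβ, abs_mul, abs_mul, abs_of_pos hb]
      have h1 : |s k (i - j)| * (I.β (I.e k) * |ζ k (up i j)|) ≤ 1 * (I.β (I.e k) * 1) :=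
        mul_le_mul (hs _ _) (mul_le_mul_of_nonneg_left (hζ1 _ _) hb.le) (by positivity) zero_le_one
      linarith
    · rw [hz0 i j hij, abs_zero]
      exact I.nonneg _
  refine ⟨z, hbound, fun i j hij => ?_, fun i => ?_⟩
  · have hri : I.radial ε r i = I.phiPolar (point ε i) := by
      refine max_eq_left ?_
      by_contra h
      have : I.radial ε r i = r := max_eq_right (not_le.1 h).le
      rw [this] at hij
      exact absurd (le_max_right _ _) (not_le.2 hij)
    have hPij : I.phiPolar (point ε j) < I.phiPolar (point ε i) := by
      rw [← hri]; exact (le_max_left _ _).trans_lt hij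
    have hup1 : up i j = i := if_pos hPij.le
    have hup2 : up j i = i := if_neg (not_le.2 hPij)
    have hPi : 0 < I.phiPolar (point ε i) := (I.phiPolar_nonneg _).trans_lt hPij
    by_cases hk : ∃ k, i - j = I.e k ∨ i - j = -I.e k
    · obtain ⟨k, hk⟩ := hk
      have hk' : j - i = I.e k ∨ j - i = -I.e k := by
        rw [← neg_sub]
        rcases hk with h | h <;> rw [h]
        · exact Or.inr rfl
        · exact Or.inl (neg_neg _)
      have he : I.e k ≠ 0 := by
        intro h0
        have : i = j := by
          rcases hk with h | h <;> rw [h0] at h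
          · exact sub_eq_zero.1 h
          · exact sub_eq_zero.1 (by simpa using h)
        rw [this] at hPij
        exact lt_irrefl _ hPij
      have hne : I.e k ≠ -I.e k := fun h => he (self_eq_neg.1 h)
      rw [hz1 i j k hk, hz1 j i k hk', hup1, hup2, ← neg_sub i j]
      rcases hk with h | h
      · have hj : j = i - I.e k := by rw [← h]; abel
        have hζ : ζ k i = 1 := by
          simp only [ζ]
          rw [hri, I.coeff_eq_of_sub_e hε (hY _) (hYle _) (k := k) (by rwa [← hj]),
            div_self hPi.ne']
        rw [h, hζ]
        simp [s, hne, hne.symm]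
      · have hj : j = i + I.e k := by rw [← neg_neg (I.e k), ← h]; abel
        have hζ : ζ k i = -1 := by
          simp only [ζ]
          rw [hri, I.coeff_eq_of_add_e hε (hY _) (hYle _) (k := k) (by rwa [← hj]),
            neg_div, div_self hPi.ne']
        rw [h, hζ, I.even]
        simp [s, hne, hne.symm]
    · have h0 : I.β (i - j) = 0 :=
        le_antisymm (not_lt.1 fun h => hk ((I.pos_iff _).1 h)) (I.nonneg _)
      have h1 := hbound i j
      have h2 := hbound j i
      rw [I.beta_sub_comm j i] at h2
      rw [h0] at h1 h2 ⊢
      exact ⟨abs_nonpos_iff.1 h1, by rw [neg_zero]; exact abs_nonpos_iff.1 h2⟩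
  · let F (k : Fin m) (j : Fin N → ℤ) : ℝ := I.β (I.e k) * (ζ k (up i j) + ζ k (up j i))
    have hterm : (fun j => (z i j - z j i) / ε) = fun j => ∑ k,
        ((if j = i - I.e k then F k (i - I.e k) else 0)
          - (if j = i + I.e k then F k (i + I.e k) else 0)) / ε := by
      ext j
      rw [← Finset.sum_div]
      congr 1
      simp only [z, ← Finset.sum_sub_distrib]
      refine Finset.sum_congr rfl fun k _ => ?_
      have e1 : (i - j = I.e k) ↔ j = i - I.e k := by
        constructor <;> intro h
        · rw [← h]; abel
        · rw [h]; abel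
      have e2 : (i - j = -I.e k) ↔ j = i + I.e k := by
        constructor <;> intro h
        · rw [← neg_neg (I.e k), ← h]; abel
        · rw [h]; abel
      have e3 : (j - i = I.e k) ↔ j = i + I.e k := by
        rw [← e2, ← neg_sub, neg_eq_iff_eq_neg]
      have e4 : (j - i = -I.e k) ↔ j = i - I.e k := by
        rw [← e1, ← neg_sub, neg_inj]
      simp only [s, e1, e2, e3, e4]
      by_cases h1 : j = i - I.e k <;> by_cases h2 : j = i + I.e k
      · have h3 : F k (i - I.e k) = F k (i + I.e k) := by rw [← h1, ← h2]
        simp only [if_pos h1, if_pos h2, h3]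
        ring
      · rw [if_pos h1, if_neg h2, if_pos h1, if_neg h2, ← h1]
        simp only [F]
        ring
      · rw [if_neg h1, if_pos h2, if_neg h1, if_pos h2, ← h2]
        simp only [F]
        ring
      · simp only [if_neg h1, if_neg h2]
        ring
    have hsum : adjGrad ε z i = ∑ k, (F k (i - I.e k) - F k (i + I.e k)) / ε := by
      rw [adjGrad, hterm]
      exact tsum_sum_ite_sub_ite (fun k => i - I.e k) (fun k => i + I.e k)
        (fun k => F k (i - I.e k)) (fun k => F k (i + I.e k)) ε
    rw [hsum, Finset.sum_div]
    refine (Finset.abs_sum_le_sum_abs _ _).trans (Finset.sum_le_sum fun k _ => ?_)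
    have hb := I.beta_e_pos k
    -- Both edge values in direction e_k are within O(ε/r) of 2β(e_k) ζ_k(i), so their difference
    -- divided by ε is O(1/r).
    have hnear : ∀ j, (j = i - I.e k ∨ j = i + I.e k) →
        |F k j - 2 * I.β (I.e k) * ζ k i| ≤ 2 * I.β (I.e k) * ((C₁ + D) * (ε * B) / r) := by
      intro j hj
      have hd : ∀ l, l = i ∨ l = j → |ζ k l - ζ k i| ≤ (C₁ + D) * (ε * B) / r := by
        intro l hl
        refine hζLip k l i (ε * B) (by positivity) fun a => ?_
        rcases hl with rfl | rfl
        · rw [sub_self, abs_zero]; positivity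
        · rw [← Pi.sub_apply, ← point_sub]
          have h1 : |point ε (l - i) a| = ε * |(I.e k a : ℝ)| := by
            rcases hj with rfl | rfl
            · rw [sub_sub_cancel_left]; simp [point, abs_mul, abs_of_pos hε]
            · rw [add_sub_cancel_left]; simp [point, abs_mul, abs_of_pos hε]
          rw [h1]
          exact mul_le_mul_of_nonneg_left (heB k a) hε.le
      have h1 := hd _ (hup i j)
      have h2 := hd _ (hup j i).symm
      have h3 : F k j - 2 * I.β (I.e k) * ζ k i
          = I.β (I.e k) * ((ζ k (up i j) - ζ k i) + (ζ k (up j i) - ζ k i)) := by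
        simp only [F]; ring
      rw [h3, abs_mul, abs_of_pos hb]
      have h4 := (abs_add_le (ζ k (up i j) - ζ k i) (ζ k (up j i) - ζ k i)).trans (add_le_add h1 h2)
      have := mul_le_mul_of_nonneg_left h4 hb.le
      linarith
    have h1 := abs_le.1 (hnear _ (Or.inl rfl))
    have h2 := abs_le.1 (hnear _ (Or.inr rfl))
    have h3 : |F k (i - I.e k) - F k (i + I.e k)|
        ≤ 4 * I.β (I.e k) * ((C₁ + D) * (ε * B) / r) := by
      rw [abs_le]; constructor <;> linarith
    rw [abs_div, abs_of_pos hε, div_le_iff₀ hε]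
    refine h3.trans (le_of_eq ?_)
    field_simp

/-- One step of the scheme lowers the radius of a truncated Wulff cone by at most `C h / r`. -/
theorem exists_step_bound : ∃ C : ℝ, 0 ≤ C ∧ ∀ (ε h r R : ℝ), 0 < ε → 0 < h → 0 < r →
    ∀ g u z, I.SolvesROF ε h g u z → (∀ i, g i ≤ I.radial ε r i - R) →
      ∀ i, u i ≤ I.radial ε r i - R + C / r * h := by
  obtain ⟨C, hC, hcal⟩ := I.exists_calibration
  refine ⟨C, hC, fun ε h r R hε hh hr g u z H hg i => ?_⟩
  obtain ⟨z', hz', hz'cal, hdiv⟩ := hcal ε r hε hr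
  have hrad : ∀ i, 0 < I.radial ε r i := fun i => hr.trans_le (le_max_right _ _)
  set B := 2 / ε * ∑' d, I.β d
  -- The slope 1 + κ keeps the order of the cone, hence its calibration, and makes {w < u} finite as
  -- comparison requires. Then κ tends to 0.
  have key : ∀ κ : ℝ, 0 < κ → u i ≤ (1 + κ) * I.radial ε r i - R + C / r * h := by
    intro κ hκ
    refine H.le_of_supersolution hε hh hz' (w := fun i => (1 + κ) * I.radial ε r i - R + C / r * h)
      (fun i j hij => hz'cal i j ?_) (fun i => ?_) ?_ i
    · by_contra hle
      have := mul_le_mul_of_nonneg_left (not_lt.1 hle) (by linarith : 0 ≤ 1 + κ)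
      linarith
    · have h1 := mul_le_mul_of_nonneg_left (abs_le.1 (hdiv i)).1 hh.le
      have h2 := hg i
      have h3 := mul_pos hκ (hrad i)
      linarith
    · refine (I.finite_phiPolar_point_le hε (h * B / κ)).subset fun i hi => ?_
      have h1 := H.eq i
      have h2 := mul_le_mul_of_nonneg_left (abs_le.1 (I.abs_adjGrad_le H.bound hε i)).1 hh.le
      have h3 := hg i
      have h4 : 0 ≤ C / r * h := by positivity
      have h5 : (1 + κ) * I.radial ε r i - R + C / r * h < u i := hi
      refine (le_max_left _ r).trans ?_
      change I.radial ε r i ≤ _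
      rw [le_div_iff₀ hκ]
      simp only [B]
      linarith
  refine le_of_forall_pos_le_add fun η hη => ?_
  have := key (η / I.radial ε r i) (div_pos hη (hrad i))
  rw [add_mul, div_mul_cancel₀ _ (hrad i).ne'] at this
  linarith

end Interaction
end CrystalScheme

/-! ### Redistancing and lattice geodesics -/

namespace CrystalScheme

/-- Among `m` numbers, some open interval `(l - a, l)` with `a ≤ l ≤ ρ` contains none. -/
theorem exists_gap {m : ℕ} (y : Fin m → ℝ) {a ρ : ℝ} (ha : 0 < a) (hρ : (m + 1) * a ≤ ρ) :
    ∃ l, a ≤ l ∧ l ≤ ρ ∧ ∀ k, y k ≤ l - a ∨ l ≤ y k := by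
  by_contra! hne
  -- Pigeonhole: otherwise the m + 1 disjoint intervals (ta, (t+1)a) would each contain one of the m
  -- numbers.
  have h : ∀ t : Fin (m + 1), ∃ k, (t : ℝ) * a < y k ∧ y k < (t + 1) * a := by
    intro t
    have ht : ((t : ℕ) : ℝ) ≤ m := by exact_mod_cast Nat.lt_succ_iff.1 t.2
    obtain ⟨k, h1, h2⟩ := hne (((t : ℕ) + 1) * a) (by nlinarith [(t : ℕ).cast_nonneg (α := ℝ)])
      (by nlinarith)
    exact ⟨k, by linarith, h2⟩
  choose f hf using h
  obtain ⟨s, t, hst, hfst⟩ := Fintype.exists_ne_map_eq_of_card_lt f (by simp)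
  have hlt : ∀ s t : Fin (m + 1), f s = f t → s ≤ t := by
    intro s t h
    by_contra hts
    have h1 : ((t : ℕ) : ℝ) + 1 ≤ (s : ℕ) := by exact_mod_cast Nat.succ_le_of_lt (not_le.1 hts)
    have h2 := (hf s).1
    have h3 := (hf t).2
    rw [h] at h2
    nlinarith
  exact hst (le_antisymm (hlt s t hfst) (hlt t s hfst.symm))

namespace Interaction
variable {N m : ℕ} (I : Interaction N m)

section
variable (ε r : ℝ) (i j : Fin N → ℤ)

theorem latDist_nonneg : 0 ≤ I.latDist ε i j := I.phiPolar_nonneg _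

theorem latDist_self : I.latDist ε i i = 0 := by rw [latDist, sub_self, phiPolar_zero]

theorem latDist_comm : I.latDist ε i j = I.latDist ε j i := I.phiPolar_sub_comm _ _

theorem latDist_triangle (l : Fin N → ℤ) :
    I.latDist ε i l ≤ I.latDist ε i j + I.latDist ε j l := by
  simpa [latDist] using I.phiPolar_add_le (point ε i - point ε j) (point ε j - point ε l)

theorem phiPolar_point_le : I.phiPolar (point ε i) ≤ I.phiPolar (point ε j) + I.latDist ε i j :=
  I.phiPolar_le_add_sub _ _

theorem latDist_le : I.latDist ε i j ≤ I.phiPolar (point ε i) + I.phiPolar (point ε j) := by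
  have := I.phiPolar_add_le (point ε i) (-point ε j)
  rwa [phiPolar_neg, ← sub_eq_add_neg] at this

theorem radial_le : I.radial ε r i ≤ I.radial ε r j + I.latDist ε i j := by
  have h1 := I.phiPolar_point_le ε i j
  have h2 := I.latDist_nonneg ε i j
  refine max_le ?_ ?_
  · linarith [le_max_left (I.phiPolar (point ε j)) r, show I.radial ε r j = max _ _ from rfl]
  · linarith [le_max_right (I.phiPolar (point ε j)) r, show I.radial ε r j = max _ _ from rfl]

theorem phiPolar_le_radial : I.phiPolar (point ε i) ≤ I.radial ε r i := le_max_left _ _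

end

/-- Redistancing preserves an upper bound by a truncated Wulff cone, up to the error `η` in
realizing distances along lattice paths. -/
theorem sd_bounds {ε r R η C : ℝ} {u : (Fin N → ℤ) → ℝ} {l : Fin N → ℤ}
    (hl : 0 ≤ u l) (hup : ∀ i, 0 ≤ u i → u i ≤ I.radial ε r i - R)
    (hlow : ∀ i, -I.phiPolar (point ε i) - C ≤ u i)
    (hpath : ∀ i, ∃ j, u j ≤ 0 ∧ I.radial ε r j + I.latDist ε i j ≤ I.radial ε r i + η)
    (hpath' : ∀ i, 0 ≤ u i → ∃ j, u j ≤ 0 ∧ u j + I.latDist ε i j ≤ I.radial ε r i - R + η) :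
    (∀ i, I.sd ε u i ≤ I.radial ε r i - R + η) ∧
      ∃ C', ∀ i, -I.phiPolar (point ε i) - C' ≤ I.sd ε u i := by
  have : Nonempty {j // 0 ≤ u j} := ⟨⟨l, hl⟩⟩
  have : Nonempty {j // u j ≤ 0} := let ⟨j, hj, _⟩ := hpath l; ⟨⟨j, hj⟩⟩
  have hdm : ∀ i, ∀ j : {j // 0 ≤ u j}, u j - I.latDist ε i j ≤ I.radial ε r i - R := by
    intro i j
    have h1 := hup j j.2
    have h2 := I.radial_le ε r j i
    rw [I.latDist_comm] at h2
    linarith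
  have hdm1 : ∀ i, I.dMinus ε u i ≤ I.radial ε r i - R := fun i => ciSup_le (hdm i)
  -- The lower bounds ensure that the real infima below are not default values. They are also
  -- propagated in time, which replaces a Lipschitz estimate for the later u^k.
  have hdm2 : ∀ i, -I.phiPolar (point ε i) - I.phiPolar (point ε l) ≤ I.dMinus ε u i := by
    intro i
    have h1 := le_ciSup (f := fun j : {j // 0 ≤ u j} => u j - I.latDist ε i j)
      ⟨_, Set.forall_mem_range.2 (hdm i)⟩ ⟨l, hl⟩
    have h2 := I.latDist_le ε i l
    refine le_trans ?_ h1
    dsimp only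
    linarith
  have hsm : ∀ i, ∀ j : {j // u j ≤ 0}, -I.phiPolar (point ε i) - I.phiPolar (point ε l) ≤
      I.dMinus ε u j + I.latDist ε i j := by
    intro i j
    have h1 := hdm2 j
    have h2 := I.phiPolar_point_le ε j i
    rw [I.latDist_comm] at h2
    linarith
  have hsm1 : ∀ i, I.sdMinus ε u i ≤ I.radial ε r i - R + η := by
    intro i
    obtain ⟨j, hj, hij⟩ := hpath i
    have h1 := ciInf_le (f := fun j : {j // u j ≤ 0} => I.dMinus ε u j + I.latDist ε i j)
      ⟨_, Set.forall_mem_range.2 (hsm i)⟩ ⟨j, hj⟩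
    refine h1.trans ?_
    dsimp only
    linarith [hdm1 j]
  have hsm2 : ∀ i, -I.phiPolar (point ε i) - I.phiPolar (point ε l) ≤ I.sdMinus ε u i :=
    fun i => le_ciInf (hsm i)
  have hdp : ∀ i, ∀ j : {j // u j ≤ 0}, -I.phiPolar (point ε i) - C ≤ u j + I.latDist ε i j := by
    intro i j
    have h1 := hlow j
    have h2 := I.phiPolar_point_le ε j i
    rw [I.latDist_comm] at h2
    linarith
  have hdp1 : ∀ i, 0 ≤ u i → I.dPlus ε u i ≤ I.radial ε r i - R + η := by
    intro i hi
    obtain ⟨j, hj, hij⟩ := hpath' i hi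
    exact (ciInf_le (f := fun j : {j // u j ≤ 0} => u j + I.latDist ε i j)
      ⟨_, Set.forall_mem_range.2 (hdp i)⟩ ⟨j, hj⟩).trans hij
  have hsp : ∀ i, ∀ j : {j // 0 ≤ u j}, I.dPlus ε u j - I.latDist ε i j ≤
      I.radial ε r i - R + η := by
    intro i j
    have h1 := hdp1 j j.2
    have h2 := I.radial_le ε r j i
    rw [I.latDist_comm] at h2
    linarith
  have hsp1 : ∀ i, I.sdPlus ε u i ≤ I.radial ε r i - R + η := fun i => ciSup_le (hsp i)
  have hsp2 : ∀ i, -I.phiPolar (point ε i) - (C + 2 * I.phiPolar (point ε l)) ≤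
      I.sdPlus ε u i := by
    intro i
    have h1 := le_ciSup (f := fun j : {j // 0 ≤ u j} => I.dPlus ε u j - I.latDist ε i j)
      ⟨_, Set.forall_mem_range.2 (hsp i)⟩ ⟨l, hl⟩
    have h2 := I.latDist_le ε i l
    have h3 : -I.phiPolar (point ε l) - C ≤ I.dPlus ε u l := le_ciInf (hdp l)
    refine le_trans ?_ h1
    dsimp only
    linarith
  refine ⟨fun i => ?_, 1 / 2 * (C + 3 * I.phiPolar (point ε l)), fun i => ?_⟩
  · rw [sd]; linarith [hsm1 i, hsp1 i]
  · rw [sd]; linarith [hsm2 i, hsp2 i]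

theorem exists_point_near : ∃ C : ℝ, 0 < C ∧ ∀ ε : ℝ, 0 < ε → ∀ x : Fin N → ℝ,
    ∃ j, I.phiPolar (x - point ε j) ≤ C * ε := by
  obtain ⟨C, hC, h⟩ := I.exists_phiPolar_le
  refine ⟨C, hC, fun ε hε x => ⟨fun a => ⌊x a / ε⌋, h _ _ (fun a => ?_) hε.le⟩⟩
  have h1 := mul_le_mul_of_nonneg_left (Int.floor_le (x a / ε)) hε.le
  have h2 := mul_lt_mul_of_pos_left (Int.lt_floor_add_one (x a / ε)) hε
  have h3 : ε * (x a / ε) = x a := by field_simp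
  rw [h3] at h1 h2
  simp only [Pi.sub_apply, point]
  rw [abs_le]
  constructor <;> linarith

/-- Every lattice point is joined to the Wulff shape of radius `ρ` with an error `O(ε)`. -/
theorem exists_near_segment : ∃ C : ℝ, 0 < C ∧ ∀ ε : ℝ, 0 < ε → ∀ (i : Fin N → ℤ) (ρ : ℝ), 0 ≤ ρ →
    ρ ≤ I.phiPolar (point ε i) → 0 < I.phiPolar (point ε i) →
    ∃ j, I.phiPolar (point ε j) ≤ ρ + C * ε ∧
      I.latDist ε i j ≤ I.phiPolar (point ε i) - ρ + C * ε := by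
  obtain ⟨C, hC, h⟩ := I.exists_point_near
  refine ⟨C, hC, fun ε hε i ρ hρ hρi hi => ?_⟩
  set P := I.phiPolar (point ε i)
  set x := (ρ / P) • point ε i
  obtain ⟨j, hj⟩ := h ε hε x
  have hx1 : I.phiPolar x ≤ ρ := by
    refine (I.phiPolar_smul_le _ _).trans ?_
    rw [abs_of_nonneg (by positivity)]
    exact (div_mul_cancel₀ ρ hi.ne').le
  have hx2 : I.phiPolar (point ε i - x) ≤ P - ρ := by
    have h1 : point ε i - x = (1 - ρ / P) • point ε i := by rw [sub_smul, one_smul]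
    rw [h1]
    refine (I.phiPolar_smul_le _ _).trans ?_
    rw [abs_of_nonneg (by rw [sub_nonneg, div_le_one hi]; exact hρi)]
    change (1 - ρ / P) * P ≤ _
    rw [sub_mul, div_mul_cancel₀ _ hi.ne', one_mul]
  refine ⟨j, ?_, ?_⟩
  · have := I.phiPolar_le_add_sub (point ε j) x
    rw [I.phiPolar_sub_comm] at this
    linarith
  · have := I.phiPolar_add_le (point ε i - x) (x - point ε j)
    rw [sub_add_sub_cancel] at this
    rw [latDist]
    linarith

/-- Under the rationality condition, one can move towards the origin along the lattice without
losing any distance. -/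
theorem exists_descent {L ε : ℝ} (hL : 0 < L) (hε : 0 < ε)
    (hRZ : ∀ s : Fin m → ℤ, (∀ k, s k = 0 ∨ s k = 1 ∨ s k = -1) →
      ∃ ℓ : ℝ, 0 < ℓ ∧ ℓ ≤ L ∧ ∃ p : Fin N → ℤ, ∀ a,
        ℓ * ∑ k, 2 * I.β (I.e k) * (s k : ℝ) * (I.e k a : ℝ) = (p a : ℝ))
    (i : Fin N → ℤ) (hi : (m + 1) * (L * ε) ≤ I.phiPolar (point ε i)) :
    ∃ j τ, 0 < τ ∧ τ ≤ L * ε ∧ I.phiPolar (point ε j) ≤ I.phiPolar (point ε i) - τ ∧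
      I.latDist ε i j ≤ τ := by
  obtain ⟨y, hy, hyk⟩ := I.exists_zono_eq (point ε i)
  set P := I.phiPolar (point ε i)
  obtain ⟨l, hal, hlP, hgap⟩ := exists_gap (fun k => |y k|) (mul_pos hL hε) hi
  -- Only the coefficients above the gap are lowered, by τ ≤ Lε, in absolute value. Those below the
  -- gap are at most l − Lε ≤ φ° − τ already, so φ° drops by the full length τ of the step.
  let s : Fin m → ℤ := fun k => if l ≤ |y k| then (SignType.sign (y k) : ℤ) else 0
  have hs : ∀ k, s k = 0 ∨ s k = 1 ∨ s k = -1 := by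
    intro k
    simp only [s]
    split_ifs
    · rcases SignType.sign (y k) <;> simp
    · exact Or.inl rfl
  obtain ⟨ℓ, hℓ, hℓL, p, hp⟩ := hRZ s hs
  set τ := ℓ * ε
  have hτ : 0 < τ := mul_pos hℓ hε
  have hτL : τ ≤ L * ε := mul_le_mul_of_nonneg_right hℓL hε.le
  have hpz : point ε p = I.zono (τ • fun k => (s k : ℝ)) := by
    rw [zono_smul]
    ext a
    simp only [point, ← hp a, Pi.smul_apply, smul_eq_mul, zono, τ]
    ring
  have hpt : I.phiPolar (point ε p) ≤ τ := by
    rw [hpz]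
    refine I.phiPolar_zono_le hτ.le fun k => ?_
    simp only [Pi.smul_apply, smul_eq_mul]
    rcases hs k with h | h | h <;> rw [h] <;> simp [abs_of_pos hτ, hτ.le]
  refine ⟨i - p, τ, hτ, hτL, ?_, ?_⟩
  · have h1 : point ε (i - p) = I.zono (y + (-1 : ℝ) • (τ • fun k => (s k : ℝ))) := by
      rw [point_sub, zono_add, zono_smul, hy, hpz, neg_one_smul, ← sub_eq_add_neg]
    rw [h1]
    refine I.phiPolar_zono_le (by linarith) fun k => ?_
    simp only [Pi.add_apply, Pi.smul_apply, smul_eq_mul, s]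
    split_ifs with hk
    · have h2 := hyk k
      rcases lt_trichotomy (y k) 0 with h | h | h
      · rw [abs_of_neg h] at h2 hk
        simp only [sign_neg h, SignType.coe_neg_one, Int.cast_neg, Int.cast_one]
        rw [abs_le]; constructor <;> linarith
      · rw [h, abs_zero] at hk
        linarith
      · rw [abs_of_pos h] at h2 hk
        simp only [sign_pos h, SignType.coe_one, Int.cast_one]
        rw [abs_le]; constructor <;> linarith
    · rcases hgap k with h | h
      · simp only [Int.cast_zero, mul_zero, add_zero]
        linarith
      · exact absurd h hk
  · rw [latDist, point_sub, sub_sub_cancel]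
    exact hpt

/-- Descent steps are chained without loss. The chain is replaced by a minimizer of φ° among the
finitely many points outside radius R that lie exactly on the way to `i`; one more step must enter
the shape, by at most Lε. -/
theorem exists_geodesic {L ε R : ℝ} (hL : 0 < L) (hε : 0 < ε)
    (hRZ : ∀ s : Fin m → ℤ, (∀ k, s k = 0 ∨ s k = 1 ∨ s k = -1) →
      ∃ ℓ : ℝ, 0 < ℓ ∧ ℓ ≤ L ∧ ∃ p : Fin N → ℤ, ∀ a,
        ℓ * ∑ k, 2 * I.β (I.e k) * (s k : ℝ) * (I.e k a : ℝ) = (p a : ℝ))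
    (hR : (m + 1) * (L * ε) ≤ R) (i : Fin N → ℤ) (hi : R < I.phiPolar (point ε i)) :
    ∃ j, R - L * ε ≤ I.phiPolar (point ε j) ∧ I.phiPolar (point ε j) ≤ R ∧
      I.phiPolar (point ε j) + I.latDist ε i j ≤ I.phiPolar (point ε i) := by
  let T : Set (Fin N → ℤ) := {j | R < I.phiPolar (point ε j) ∧
    I.phiPolar (point ε j) + I.latDist ε i j ≤ I.phiPolar (point ε i)}
  have hT : T.Finite := (I.finite_phiPolar_point_le hε (I.phiPolar (point ε i))).subset
    fun j hj => (le_add_of_nonneg_right (I.latDist_nonneg ε i j)).trans hj.2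
  obtain ⟨j, hj, hmin⟩ := Set.exists_min_image T (fun j => I.phiPolar (point ε j)) hT
    ⟨i, hi, by rw [latDist_self, add_zero]⟩
  obtain ⟨j', τ, hτ, hτL, h1, h2⟩ := I.exists_descent hL hε hRZ j (hR.trans hj.1.le)
  have h3 := I.latDist_triangle ε i j j'
  have h4 := I.phiPolar_point_le ε j j'
  have h5 := hj.1
  have h6 := hj.2
  have h7 : I.phiPolar (point ε j') + I.latDist ε i j' ≤ I.phiPolar (point ε i) := by linarith
  refine ⟨j', by linarith, ?_, h7⟩
  by_contra h8
  have := hmin j' ⟨not_le.1 h8, h7⟩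
  linarith

end Interaction
end CrystalScheme

/-! ### Error terms and induction over time steps -/

namespace CrystalScheme
namespace Interaction
variable {N m : ℕ} (I : Interaction N m)

theorem point_zero (ε : ℝ) : point ε (0 : Fin N → ℤ) = 0 := by ext a; simp [point]

/-- In each of the two regimes, distances to Wulff shapes are realized on the lattice up to an error
`η` which is controlled by the time step. -/
theorem exists_path_error (K : ℝ) {r : ℝ} (hr : 0 < r) : ∃ ε₀ C : ℝ, 0 < ε₀ ∧ 0 ≤ C ∧
    ∀ ε h : ℝ, 0 < ε → ε ≤ ε₀ → 0 < h → (ε ≤ K * h ∨ I.RationalZonotope) →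
      ∃ η, 0 ≤ η ∧ η ≤ C * h ∧ ∀ R, 2 * r ≤ R → ∀ i, R < I.phiPolar (point ε i) →
        ∃ j, I.radial ε r j ≤ R ∧ I.radial ε r j + I.latDist ε i j ≤ I.radial ε r i + η := by
  obtain ⟨C, hC, hseg⟩ := I.exists_near_segment
  have hgen : ∃ ε₁, 0 < ε₁ ∧ ∀ ε h : ℝ, 0 < ε → ε ≤ ε₁ → 0 < h → ε ≤ K * h →
      ∃ η, 0 ≤ η ∧ η ≤ 2 * C * |K| * h ∧ ∀ R, 2 * r ≤ R → ∀ i, R < I.phiPolar (point ε i) →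
        ∃ j, I.radial ε r j ≤ R ∧ I.radial ε r j + I.latDist ε i j ≤ I.radial ε r i + η := by
    refine ⟨r / C, by positivity, fun ε h hε hε₁ hh hK => ⟨2 * C * ε, by positivity, ?_, ?_⟩⟩
    · have : ε ≤ |K| * h := hK.trans (mul_le_mul_of_nonneg_right (le_abs_self K) hh.le)
      nlinarith
    · intro R hR i hi
      rw [le_div_iff₀ hC] at hε₁
      have hCε : 0 < C * ε := by positivity
      -- Aiming at radius R − Cε absorbs the rounding, so `j` stays within radius R and the total
      -- loss is 2Cε.
      obtain ⟨j, h1, h2⟩ := hseg ε hε i (R - C * ε) (by linarith) (by linarith) (by linarith)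
      have h3 : I.radial ε r j ≤ R := max_le (by linarith) (by linarith)
      refine ⟨j, h3, ?_⟩
      have := I.phiPolar_le_radial ε r i
      linarith
  obtain ⟨ε₁, hε₁, hgen⟩ := hgen
  by_cases hRZ : I.RationalZonotope
  · obtain ⟨L, hL, hRZ'⟩ := hRZ
    have hLm : 0 < (m + 1) * L := by positivity
    refine ⟨min ε₁ (r / ((m + 1) * L)), 2 * C * |K|, by positivity, by positivity,
      fun ε h hε hε₀ hh _ => ⟨0, le_rfl, by positivity, fun R hR i hi => ?_⟩⟩
    have h1 := hε₀.trans (min_le_right _ _)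
    rw [le_div_iff₀ hLm] at h1
    have h2 : (m + 1) * (L * ε) ≤ r := by linarith
    have h3 : L * ε ≤ r := by nlinarith [mul_pos hL hε, (Nat.cast_nonneg m : (0 : ℝ) ≤ m)]
    obtain ⟨j, hj1, hj2, hj3⟩ := I.exists_geodesic hL hε hRZ' (by linarith) i hi
    have hj : I.radial ε r j = I.phiPolar (point ε j) := max_eq_left (by linarith)
    refine ⟨j, hj ▸ hj2, ?_⟩
    have := I.phiPolar_le_radial ε r i
    linarith
  · exact ⟨ε₁, 2 * C * |K|, hε₁, by positivity, fun ε h hε hε₀ hh hor =>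
      hgen ε h hε hε₀ hh (hor.resolve_right hRZ)⟩

/-- Redistancing of an initial function which is negative on a Wulff shape. -/
theorem exists_initial_error : ∃ C : ℝ, 0 < C ∧ ∀ (ε r R : ℝ), 0 < ε → 0 < r → C * ε ≤ r →
    2 * r ≤ R → ∀ u : (Fin N → ℤ) → ℝ, I.IsLip ε u →
      (∀ i, I.phiPolar (point ε i) < R → u i < 0) → (∃ l, 0 ≤ u l) →
      (∀ i, I.sd ε u i ≤ I.radial ε r i - (R - C * ε)) ∧
        ∃ C', ∀ i, -I.phiPolar (point ε i) - C' ≤ I.sd ε u i := by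
  obtain ⟨C, hC, hseg⟩ := I.exists_near_segment
  -- Three units of Cε bound `u` by the cone on {u ≥ 0}; two more come from redistancing. Aiming
  -- below at radius R − 2Cε keeps the rounded point strictly inside, where `u` is negative.
  refine ⟨5 * C, by positivity, fun ε r R hε hr hεr hR u hu hneg ⟨l, hl⟩ => ?_⟩
  have hCε : 0 < C * ε := by positivity
  have hpath : ∀ i, R ≤ I.phiPolar (point ε i) → ∃ j, u j < 0 ∧ I.radial ε r j ≤ R - C * ε ∧
      I.latDist ε i j ≤ I.phiPolar (point ε i) - R + 3 * (C * ε) := by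
    intro i hi
    obtain ⟨j, h1, h2⟩ :=
      hseg ε hε i (R - 2 * (C * ε)) (by linarith) (by linarith) (by linarith)
    exact ⟨j, hneg j (by linarith), max_le (by linarith) (by linarith), by linarith⟩
  have hpos : ∀ i, 0 ≤ u i → R ≤ I.phiPolar (point ε i) := fun i hi => by
    by_contra h
    exact absurd (hneg i (not_le.1 h)) (not_lt.2 hi)
  have h := I.sd_bounds (ε := ε) (r := r) (R := R - 3 * (C * ε)) (η := 2 * (C * ε)) (C := |u 0|)
    (u := u) (l := l) hl ?_ ?_ ?_ ?_
  · refine ⟨fun i => (h.1 i).trans (le_of_eq (by ring)), h.2⟩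
  · intro i hi
    obtain ⟨j, h1, h2, h3⟩ := hpath i (hpos i hi)
    have h4 := (abs_le.1 (hu i j)).2
    have := I.phiPolar_le_radial ε r i
    linarith
  · intro i
    have h1 := (abs_le.1 (hu i 0)).1
    have h2 := neg_abs_le (u 0)
    rw [latDist, point_zero, sub_zero] at h1
    linarith
  · intro i
    rcases lt_or_ge (I.phiPolar (point ε i)) R with hi | hi
    · exact ⟨i, (hneg i hi).le, by rw [latDist_self]; linarith⟩
    · obtain ⟨j, h1, h2, h3⟩ := hpath i hi
      have := I.phiPolar_le_radial ε r i
      exact ⟨j, h1.le, by linarith⟩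
  · intro i hi
    obtain ⟨j, h1, h2, h3⟩ := hpath i (hpos i hi)
    have := I.phiPolar_le_radial ε r i
    exact ⟨j, h1.le, by linarith⟩

theorem initialSet_of_wulff_subset {ε R : ℝ} (hε : 0 < ε) {W : Set (Fin N → ℝ)}
    (hW : I.wulff R ⊆ W) {i : Fin N → ℤ} (hi : I.phiPolar (point ε i) < R) :
    i ∈ initialSet ε W :=
  ⟨point ε i, hW hi, fun _ => ⟨le_rfl, lt_add_of_pos_right _ hε⟩⟩

/-- The inductive bound on an evolution: the sets contain shrinking Wulff shapes, and the signed
distances are bounded by the corresponding truncated cones. -/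
def Barrier (ε r R : ℝ) (u : (Fin N → ℤ) → ℝ) (E : Set (Fin N → ℤ)) : Prop :=
  (∀ i, I.phiPolar (point ε i) < R → i ∈ E) ∧
    (E = Set.univ ∨ ((∀ i, I.sd ε u i ≤ I.radial ε r i - R) ∧
      ∃ C, ∀ i, -I.phiPolar (point ε i) - C ≤ I.sd ε u i))

theorem Barrier.succ {I : Interaction N m} {ε h r R η A : ℝ} (hε : 0 < ε) (hh : 0 < h) (hr : 0 < r)
    (hη : 0 ≤ η) (hA : 0 ≤ A) {u : ℕ → (Fin N → ℤ) → ℝ} {E : ℕ → Set (Fin N → ℤ)}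
    {W : Set (Fin N → ℝ)} (hE : I.IsEvolution ε h W u E) {k : ℕ}
    (hstep : ∀ g u z, I.SolvesROF ε h g u z → (∀ i, g i ≤ I.radial ε r i - R) →
      ∀ i, u i ≤ I.radial ε r i - R + A)
    (hpath : ∀ R, 2 * r ≤ R → ∀ i, R < I.phiPolar (point ε i) →
        ∃ j, I.radial ε r j ≤ R ∧ I.radial ε r j + I.latDist ε i j ≤ I.radial ε r i + η)
    (hR : 2 * r ≤ R - (A + η)) (H : I.Barrier ε r R (u k) (E k)) :
    I.Barrier ε r (R - (A + η)) (u (k + 1)) (E (k + 1)) := by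
  obtain ⟨hsub, huniv | ⟨hsd, C, hlow⟩⟩ := H
  · have := hE.frozen k (Or.inr huniv)
    rw [this, huniv]
    exact ⟨fun _ _ => Set.mem_univ _, Or.inl rfl⟩
  by_cases huniv : E k = Set.univ
  · have := hE.frozen k (Or.inr huniv)
    rw [this, huniv]
    exact ⟨fun _ _ => Set.mem_univ _, Or.inl rfl⟩
  -- The origin lies in the barrier, so the evolution has not been frozen at the empty set.
  have hne : E k ≠ ∅ := Set.nonempty_iff_ne_empty.1
    ⟨0, hsub 0 (by rw [point_zero, phiPolar_zero]; linarith)⟩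
  obtain ⟨⟨z, hz⟩, hEk⟩ := hE.step k hne huniv
  have hu := hstep _ _ _ hz hsd
  have hmem : ∀ i, I.radial ε r i ≤ R - A → u (k + 1) i ≤ 0 := fun i hi => by linarith [hu i]
  have hself : ∀ i, I.phiPolar (point ε i) ≤ R - A → I.radial ε r i ≤ R - A := fun i hi =>
    max_le hi (by linarith)
  have hpath' : ∀ i, ∃ j, u (k + 1) j ≤ 0 ∧
      I.radial ε r j + I.latDist ε i j ≤ I.radial ε r i + η := by
    intro i
    rcases le_or_gt (I.phiPolar (point ε i)) (R - A) with hi | hi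
    · exact ⟨i, hmem i (hself i hi), by rw [latDist_self]; linarith⟩
    · obtain ⟨j, h1, h2⟩ := hpath (R - A) (by linarith) i hi
      exact ⟨j, hmem j h1, h2⟩
  refine ⟨fun i hi => ?_, ?_⟩
  · rw [hEk]
    exact hmem i (hself i (by linarith))
  · by_cases huniv' : E (k + 1) = Set.univ
    · exact Or.inl huniv'
    · right
      obtain ⟨l, hl⟩ := (Set.ne_univ_iff_exists_notMem _).1 huniv'
      rw [hEk] at hl
      have h := I.sd_bounds (ε := ε) (r := r) (R := R - A) (η := η)
        (C := C + h * (2 / ε * ∑' d, I.β d)) (u := u (k + 1)) (l := l) (not_le.1 hl).le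
        (fun i _ => by linarith [hu i]) (fun i => ?_) hpath' (fun i _ => ?_)
      · exact ⟨fun i => (h.1 i).trans (by linarith), h.2⟩
      · have h1 := hz.eq i
        have h2 := mul_le_mul_of_nonneg_left (abs_le.1 (I.abs_adjGrad_le hz.bound hε i)).2 hh.le
        have h3 := hlow i
        linarith
      · obtain ⟨j, h1, h2⟩ := hpath' i
        exact ⟨j, h1, by linarith [hu j]⟩

end Interaction
end CrystalScheme

theorem proposition4p11 {N m : ℕ} (hN : 1 ≤ N) (I : CrystalScheme.Interaction N m)
    (K δ : ℝ) (hδ : 0 < δ) :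
    ∃ ε₀ h₀ c₀ : ℝ, 0 < ε₀ ∧ 0 < h₀ ∧ 0 < c₀ ∧
      ∀ ε h R : ℝ, 0 < ε → ε ≤ ε₀ → 0 < h → h ≤ h₀ →
        (ε ≤ K * h ∨ I.RationalZonotope) → δ ≤ R →
        ∀ (W₀ : Set (Fin N → ℝ)), (W₀ = I.wulff R ∨ W₀ = closure (I.wulff R)) →
        ∀ (u : ℕ → (Fin N → ℤ) → ℝ) (E : ℕ → Set (Fin N → ℤ)), I.IsEvolution ε h W₀ u E →
        ∀ t : ℝ, 0 ≤ t → δ / 2 ≤ R - c₀ * (t + ε) →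
          I.wulff (R - c₀ * (t + ε)) ∩ CrystalScheme.lattice N ε ⊆
            CrystalScheme.evolvedSet ε h E t := by
  obtain ⟨A, hA, hstep⟩ := I.exists_step_bound
  obtain ⟨B, hB, hinit⟩ := I.exists_initial_error
  -- As long as the radius is at least δ/2, it exceeds twice this truncation radius, and the loss
  -- rate A/r depends on δ but not on R.
  have hr : 0 < δ / 8 := by positivity
  obtain ⟨ε₁, C, hε₁, hC, herr⟩ := I.exists_path_error K hr
  set c := A / (δ / 8) + C
  have hc : 0 ≤ c := by positivity
  -- B ε pays for the initial redistancing and c h for each of the at most t/h steps.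
  refine ⟨min ε₁ (δ / 8 / B), 1, B + c, by positivity, one_pos, by positivity, ?_⟩
  intro ε h R hε hε₀ hh _ hor hR W₀ hW₀ u E hE t ht htR
  obtain ⟨η, hη, hηh, hpath⟩ := herr ε h hε (hε₀.trans (min_le_left _ _)) hh hor
  have hBε : B * ε ≤ δ / 8 := by
    have := hε₀.trans (min_le_right _ _)
    rwa [le_div_iff₀ hB, mul_comm] at this
  have hW : I.wulff R ⊆ W₀ := by
    rcases hW₀ with rfl | rfl
    exacts [subset_rfl, subset_closure]
  set a := A / (δ / 8) * h + η
  have hac : a ≤ c * h := by simp only [a, c, add_mul]; linarith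
  have hradius : ∀ k : ℕ, (k : ℝ) * h ≤ t → R - (B + c) * (t + ε) ≤ R - B * ε - k * a := by
    intro k hk
    have h1 : (k : ℝ) * a ≤ k * (c * h) := mul_le_mul_of_nonneg_left hac k.cast_nonneg
    have h2 := mul_le_mul_of_nonneg_left hk hc
    have h3 : 0 ≤ B * t + c * ε := by positivity
    linarith
  have hmain : ∀ k : ℕ, (k : ℝ) * h ≤ t →
      I.Barrier ε (δ / 8) (R - B * ε - k * a) (u k) (E k) := by
    intro k
    induction k with
    | zero =>
      intro _
      have hBε' : 0 < B * ε := by positivity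
      rw [Nat.cast_zero, zero_mul, sub_zero]
      have hsub : ∀ i, I.phiPolar (CrystalScheme.point ε i) < R → i ∈ E 0 := fun i hi => by
        rw [hE.init]
        exact I.initialSet_of_wulff_subset hε hW hi
      refine ⟨fun i hi => hsub i (by linarith), ?_⟩
      by_cases huniv : E 0 = Set.univ
      · exact Or.inl huniv
      · obtain ⟨l, hl⟩ := (Set.ne_univ_iff_exists_notMem _).1 huniv
        exact Or.inr (hinit ε (δ / 8) R hε hr hBε (by linarith) (u 0) hE.init_lip
          (fun i hi => hE.init_neg i (hsub i hi)) ⟨l, (hE.init_pos l hl).le⟩)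
    | succ k ih =>
      intro hk
      have h1 := hradius (k + 1) hk
      push_cast at hk h1 ⊢
      have h2 : R - B * ε - (k + 1) * a = R - B * ε - k * a - a := by ring
      rw [h2] at h1 ⊢
      exact (ih (by linarith)).succ hε hh hr hη (by positivity) hE
        (hstep ε h (δ / 8) _ hε hh hr) hpath
        (show 2 * (δ / 8) ≤ R - B * ε - k * a - a by linarith)
  have hfloor : (⌊t / h⌋₊ : ℝ) * h ≤ t := by
    rw [← le_div_iff₀ hh]
    exact Nat.floor_le (by positivity)
  rintro x ⟨hx, i, rfl⟩
  exact ⟨i, (hmain _ hfloor).1 i (lt_of_lt_of_le hx (hradius _ hfloor)), rfl⟩
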